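/- Let $\mathbb{K}$ be a field of characteristic $0$ and let $\mathcal{D}$ be a non-empty class of finite groups closed under isomorphisms, subgroups, quotients and direct products (for instance all finite groups). The biset category $\mathbb{K}\mathcal{D}$ has the groups of $\mathcal{D}$ as objects, $\mathrm{Hom}(G,H)=\mathbb{K}\otimes_{\mathbb{Z}}B(H,G)$, where $B(H,G)$ is the Grothendieck group of finite $(H,G)$-bisets for disjoint union, and composition induced by $(U,V)\mapsto U\times_H V$. A Green biset functor over $\mathbb{K}\mathcal{D}$ is a $\mathbb{K}$-linear functor $A:\mathbb{K}\mathcal{D}\to\mathbb{K}\text{-Mod}$ such that every $A(G)$ is a unital associative $\mathbb{K}$-algebra and, for every homomorphism $\varphi:K\to G$ of groups of $\mathcal{D}$, with $\varphi^*=A({}_{K^\varphi}G_G)$ and $\varphi_*=A({}_GG_{{}^\varphi K})$, the map $\varphi^*:A(G)\to A(K)$ is a unital ring homomorphism and $\varphi_*(a)\cdot b=\varphi_*(a\cdot\varphi^*(b))$, $b\cdot\varphi_*(a)=\varphi_*(\varphi^*(b)\cdot a)$ for all $a\in A(K)$, $b\in A(G)$. Res and Inf are the maps of type $\varphi^*$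 for inclusions of subgroups and for projections to quotients (or to factors of a direct product); Def is the map of type $\varphi_*$ for such projections. For $a\in A(G)$, $b\in A(H)$ put $a\times b=A(\mathrm{Inf}_G^{G\times H})(a)\cdot A(\mathrm{Inf}_H^{G\times H})(b)\in A(G\times H)$. An ideal of $A$ is a biset subfunctor $I$ of $A$ such that $a\times b\in I(G\times H)$ whenever $a\in I(G)$, $b\in A(H)$ or $a\in A(G)$, $b\in I(H)$. Ideals are ordered by inclusion, sums of ideals are formed evaluation by evaluation, and the ideal generated by $x\in A(G)$ is the intersection of all ideals $I$ with $x\in I(G)$. Let $A$ be such a functor, and assume that $A(G)$ is a finite-dimensional split semisimple commutative $\mathbb{K}$-algebra for every $G\in\mathcal{D}$. Let $E_G$ be the set of primitive idempotents of $A(G)$, and for $e_G\in E_G$ let $\mathbf{e}_G$ be the ideal of $A$ generated by $e_G$. Let $\mathcal{M}$ be the class of all pairs $(H,e_H)$ with $H\in\mathcal{D}$ and $e_H\in E_H$ such that $A(\mathrm{Res}^H_K)(e_H)=0$ for every proper subgroup $K<H$ and $A(\mathrm{Def}^H_{H/N})(e_H)=0$ for every non-trivial normal subgroup $N$ of $H$.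 For $(H,e_H),(K,e_K)\in\mathcal{M}$ write $(H,e_H)\gg(K,e_K)$ if there is $x\in E_{H\times K}$ with $$e_H\cdot A(\mathrm{Def}^{H\times K}_H)\bigl(x\cdot A(\mathrm{Inf}^{H\times K}_K)(e_K)\bigr)\neq 0 .$$ Theorem. The relation $\gg$ is a preorder on $\mathcal{M}$. Let $[\mathcal{M}]$ be the partially ordered set of classes $[H,e_H]$ for the equivalence relation "$(H,e_H)\gg(K,e_K)$ and $(K,e_K)\gg(H,e_H)$", with the order induced by $\gg$, and call $B\subseteq[\mathcal{M}]$ closed if $c\gg d\in B$ implies $c\in B$. Then $$\Theta(I)=\{[H,e_H]\in[\mathcal{M}]\mid e_H\in I(H)\}$$ does not depend on the choice of representatives, and $\Theta$ is an isomorphism of posets from the set of ideals of $A$, ordered by inclusion, to the set of closed subsets of $[\mathcal{M}]$, ordered by inclusion. The inverse isomorphism sends a closed subset $B$ to $\sum_{[H,e_H]\in B}\mathbf{e}_H$, for any choice of representatives of the classes. -/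

import Mathlib

open CategoryTheory
open scoped TensorProduct

universe u w v

noncomputable section

namespace GreenBiset

/-! ### Classes of finite groups -/

/-- A non-empty class of finite groups, closed under isomorphisms, subgroups, quotients (hence under
subquotients) and direct products of two groups. -/
structure GroupClass where
  /-- the groups of the class -/
  Mem : ∀ (G : Type u) [Group G], Prop
  finite_of_mem : ∀ (G : Type u) [Group G], Mem G → Finite G
  exists_mem : ∃ (G : Type u) (_ : Group G), Mem G
  mem_of_iso : ∀ (G H : Type u) [Group G] [Group H], (G ≃* H) → Mem G → Mem H
  mem_subgroup : ∀ (G : Type u) [Group G] (K : Subgroup G), Mem G → Mem K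
  mem_quotient : ∀ (G : Type u) [Group G] (N : Subgroup G) [N.Normal], Mem G → Mem (G ⧸ N)
  mem_prod : ∀ (G H : Type u) [Group G] [Group H], Mem G → Mem H → Mem (G × H)

/-- The class of all finite groups. -/
def GroupClass.all : GroupClass.{u} where
  Mem G _ := Finite G
  finite_of_mem _ _ h := h
  exists_mem := ⟨PUnit, inferInstance, inferInstance⟩
  mem_of_iso _ _ _ _ e h := by
    have := h
    exact Finite.of_equiv _ e.toEquiv
  mem_subgroup _ _ _ h := by
    have := h
    infer_instance
  mem_quotient _ _ _ _ h := by
    have := h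
    infer_instance
  mem_prod _ _ _ _ h h' := by
    have := h
    have := h'
    infer_instance

/-! ### Finite bisets -/

/-- A finite `(H, G)`-biset: a finite set with a left action of `H` and a right action of `G` which
commute.  The right action of `g` is the action of `MulOpposite.op g`. -/
structure FinBiset (H G : Type u) [Group H] [Group G] where
  /-- the underlying set -/
  carrier : Type u
  [left : MulAction H carrier]
  [right : MulAction Gᵐᵒᵖ carrier]
  [comm : SMulCommClass H Gᵐᵒᵖ carrier]
  [finite : Finite carrier]

namespace FinBiset

instance (H G : Type u) [Group H] [Group G] : CoeSort (FinBiset H G) (Type u) := ⟨carrier⟩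

attribute [instance] left right comm finite

section

variable {K H G L : Type u} [Group K] [Group H] [Group G] [Group L]

/-- The finite biset on `X` with left action `h ⬝ x = l h x` and right action `x ⬝ g = r x g`. -/
def ofActions (X : Type u) [Finite X] (l : H → X → X) (r : X → G → X)
    (l_one : ∀ x, l 1 x = x) (l_mul : ∀ a b x, l (a * b) x = l a (l b x))
    (r_one : ∀ x, r x 1 = x) (r_mul : ∀ a b x, r x (a * b) = r (r x a) b)
    (l_r : ∀ a x b, r (l a x) b = l a (r x b)) : FinBiset H G :=
  letI : MulAction H X := { smul := l, one_smul := l_one, mul_smul := l_mul }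
  letI : MulAction Gᵐᵒᵖ X :=
    { smul := fun g x => r x g.unop
      one_smul := r_one
      mul_smul := fun a b x => r_mul b.unop a.unop x }
  { carrier := X
    comm := ⟨fun a b x => (l_r a x b.unop).symm⟩ }

/-- An isomorphism of `(H, G)`-bisets: a bijection which commutes with both actions. -/
structure Iso (U V : FinBiset H G) extends U.carrier ≃ V.carrier where
  map_left : ∀ (h : H) (x : U), toFun (h • x) = h • toFun x
  map_right : ∀ (g : Gᵐᵒᵖ) (x : U), toFun (g • x) = g • toFun x

/-- Isomorphism of finite bisets, as an equivalence relation. -/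
instance setoid (H G : Type u) [Group H] [Group G] : Setoid (FinBiset H G) where
  r U V := Nonempty (Iso U V)
  iseqv :=
    { refl := fun U => ⟨{ Equiv.refl U.carrier with
        map_left := fun _ _ => rfl
        map_right := fun _ _ => rfl }⟩
      symm := by
        rintro U V ⟨e⟩
        refine ⟨{ e.toEquiv.symm with map_left := fun h x => ?_, map_right := fun g x => ?_ }⟩
        · apply e.toEquiv.injective
          have := e.map_left h (e.toEquiv.symm x)
          simp_all
        · apply e.toEquiv.injective
          have := e.map_right g (e.toEquiv.symm x)
          simp_all
      trans := by
        rintro U V W ⟨e⟩ ⟨f⟩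
        refine ⟨{ e.toEquiv.trans f.toEquiv with
          map_left := fun h x => ?_, map_right := fun g x => ?_ }⟩
        · exact (congrArg f.toFun (e.map_left h x)).trans (f.map_left h _)
        · exact (congrArg f.toFun (e.map_right g x)).trans (f.map_right g _) }

/-- The disjoint union of two finite bisets, with `h ⬝ inl x = inl (h ⬝ x)`, etc. -/
def sum (U V : FinBiset H G) : FinBiset H G where
  carrier := U ⊕ V

/-- The empty biset. -/
def empty (H G : Type u) [Group H] [Group G] : FinBiset H G :=
  ofActions PEmpty (fun _ x => x) (fun x _ => x) (fun _ => rfl) (fun _ _ _ => rfl) (fun _ => rfl)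
    (fun _ _ _ => rfl) (fun _ _ _ => rfl)

/-- The relation `(u ⬝ h, v) ∼ (u, h ⬝ v)` on `U × V`. -/
def tensorRel (U : FinBiset K H) (V : FinBiset H G) : Setoid (U.carrier × V.carrier) where
  r p q := ∃ h : H, p.1 = MulOpposite.op h • q.1 ∧ q.2 = h • p.2
  iseqv :=
    { refl := fun p => ⟨1, by simp, by simp⟩
      symm := by
        rintro p q ⟨h, h1, h2⟩
        refine ⟨h⁻¹, ?_, ?_⟩
        · rw [h1, smul_smul, ← MulOpposite.op_mul]; simp
        · rw [h2]; simp
      trans := by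
        rintro p q r ⟨h, h1, h2⟩ ⟨k, k1, k2⟩
        refine ⟨k * h, ?_, ?_⟩
        · rw [h1, k1, smul_smul, ← MulOpposite.op_mul]
        · rw [k2, h2, smul_smul] }

/-- The product `U ×_H V` of a `(K, H)`-biset and an `(H, G)`-biset: the quotient of `U × V` by
`(u ⬝ h, v) ∼ (u, h ⬝ v)`, with the actions `k ⬝ [u, v] ⬝ g = [k ⬝ u, v ⬝ g]`. -/
def tensor (U : FinBiset K H) (V : FinBiset H G) : FinBiset K G :=
  ofActions (Quotient (tensorRel U V))
    (fun k => Quotient.map (fun p => (k • p.1, p.2)) (by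
      rintro p q ⟨h, h1, h2⟩
      exact ⟨h, by simp only [h1, smul_comm], h2⟩))
    (fun x g => Quotient.map (fun p => (p.1, MulOpposite.op g • p.2)) (by
      rintro p q ⟨h, h1, h2⟩
      exact ⟨h, h1, by simp only [h2, smul_comm]⟩) x)
    (by
      rintro ⟨p⟩
      exact congrArg (Quotient.mk _) (Prod.ext (one_smul _ _) rfl))
    (by
      rintro a b ⟨p⟩
      exact congrArg (Quotient.mk _) (Prod.ext (mul_smul _ _ _) rfl))
    (by
      rintro ⟨p⟩
      exact congrArg (Quotient.mk _) (Prod.ext rfl (one_smul _ _)))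
    (by
      rintro a b ⟨p⟩
      exact congrArg (Quotient.mk _) (Prod.ext rfl (mul_smul (MulOpposite.op b) _ _)))
    (by
      rintro a ⟨p⟩ b
      rfl)

/-- For a group homomorphism `φ : K → G`, the `(K, G)`-biset `G` with
`k ⬝ x ⬝ g = φ(k) x g`. -/
def pull (φ : K →* G) [Finite G] : FinBiset K G :=
  ofActions G (fun k x => φ k * x) (fun x g => x * g) (by simp) (by simp [mul_assoc]) (by simp)
    (by simp [mul_assoc]) (by simp [mul_assoc])

/-- For a group homomorphism `φ : K → G`, the `(G, K)`-biset `G` with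
`g ⬝ x ⬝ k = g x φ(k)`. -/
def push (φ : K →* G) [Finite G] : FinBiset G K :=
  ofActions G (fun g x => g * x) (fun x k => x * φ k) (by simp) (by simp [mul_assoc]) (by simp)
    (by simp [mul_assoc]) (by simp [mul_assoc])

/-- The identity biset of `G`, that is `G` acting on itself by left and right multiplication. -/
def id (G : Type u) [Group G] [Finite G] : FinBiset G G where
  carrier := G

/-- Build an isomorphism of bisets. -/
lemma equiv_of {U V : FinBiset H G} (e : U.carrier ≃ V.carrier)
    (h1 : ∀ (h : H) (x : U), e (h • x) = h • e x)
    (h2 : ∀ (g : Gᵐᵒᵖ) (x : U), e (g • x) = g • e x) : U ≈ V :=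
  ⟨{ e with map_left := h1, map_right := h2 }⟩

lemma sum_congr {U U' V V' : FinBiset H G} (h : U ≈ U') (h' : V ≈ V') :
    U.sum V ≈ U'.sum V' := by
  obtain ⟨e⟩ := h
  obtain ⟨f⟩ := h'
  refine equiv_of (Equiv.sumCongr e.toEquiv f.toEquiv) ?_ ?_
  · rintro a (x | x)
    · exact congrArg Sum.inl (e.map_left a x)
    · exact congrArg Sum.inr (f.map_left a x)
  · rintro a (x | x)
    · exact congrArg Sum.inl (e.map_right a x)
    · exact congrArg Sum.inr (f.map_right a x)

lemma sum_comm' (U V : FinBiset H G) : U.sum V ≈ V.sum U :=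
  equiv_of (Equiv.sumComm _ _) (by rintro a (x | x) <;> rfl) (by rintro a (x | x) <;> rfl)

lemma sum_assoc' (U V W : FinBiset H G) : (U.sum V).sum W ≈ U.sum (V.sum W) :=
  equiv_of (Equiv.sumAssoc _ _ _) (by rintro a ((x | x) | x) <;> rfl)
    (by rintro a ((x | x) | x) <;> rfl)

lemma empty_sum (U : FinBiset H G) : (empty H G).sum U ≈ U :=
  equiv_of (Equiv.emptySum PEmpty _) (by rintro a (x | x); · exact x.elim
                                         · rfl)
    (by rintro a (x | x); · exact x.elim
        · rfl)

lemma tensor_congr {U U' : FinBiset K H} {V V' : FinBiset H G} (h : U ≈ U') (h' : V ≈ V') :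
    U.tensor V ≈ U'.tensor V' := by
  obtain ⟨e⟩ := h
  obtain ⟨f⟩ := h'
  refine equiv_of (Quotient.congr (Equiv.prodCongr e.toEquiv f.toEquiv) ?_) ?_ ?_
  · rintro p q
    constructor
    · rintro ⟨a, h1, h2⟩
      refine ⟨a, ?_, ?_⟩
      · exact (congrArg e.toFun h1).trans (e.map_right _ _)
      · exact (congrArg f.toFun h2).trans (f.map_left _ _)
    · rintro ⟨a, h1, h2⟩
      refine ⟨a, ?_, ?_⟩
      · exact e.toEquiv.injective (h1.trans (e.map_right _ _).symm)
      · exact f.toEquiv.injective (h2.trans (f.map_left _ _).symm)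
  · rintro a ⟨p⟩
    exact congrArg (Quotient.mk _) (Prod.ext (e.map_left a p.1) rfl)
  · rintro a ⟨p⟩
    exact congrArg (Quotient.mk _) (Prod.ext rfl (f.map_right a p.2))

lemma tensor_sum (U : FinBiset K H) (V W : FinBiset H G) :
    U.tensor (V.sum W) ≈ (U.tensor V).sum (U.tensor W) := by
  let e : (U.tensor (V.sum W)).carrier ≃ ((U.tensor V).sum (U.tensor W)).carrier :=
    { toFun := Quotient.lift (fun p : U × (V ⊕ W) => match p with
        | (x, .inl y) => Sum.inl (Quotient.mk (tensorRel U V) (x, y))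
        | (x, .inr y) => Sum.inr (Quotient.mk (tensorRel U W) (x, y))) (by
          rintro ⟨x, y | y⟩ ⟨x', y' | y'⟩ ⟨a, h1, h2⟩
          · exact congrArg Sum.inl (Quotient.sound ⟨a, h1, Sum.inl_injective h2⟩)
          · cases h2
          · cases h2
          · exact congrArg Sum.inr (Quotient.sound ⟨a, h1, Sum.inr_injective h2⟩))
      invFun := Sum.elim
        (Quotient.map (fun p => (p.1, Sum.inl p.2)) (by
          rintro p q ⟨a, h1, h2⟩
          exact ⟨a, h1, congrArg Sum.inl h2⟩))
        (Quotient.map (fun p => (p.1, Sum.inr p.2)) (by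
          rintro p q ⟨a, h1, h2⟩
          exact ⟨a, h1, congrArg Sum.inr h2⟩))
      left_inv := by rintro ⟨x, y | y⟩ <;> rfl
      right_inv := by rintro (⟨x, y⟩ | ⟨x, y⟩) <;> rfl }
  refine equiv_of e ?_ ?_
  · rintro a ⟨x, y | y⟩ <;> rfl
  · rintro a ⟨x, y | y⟩ <;> rfl

lemma sum_tensor (U V : FinBiset K H) (W : FinBiset H G) :
    (U.sum V).tensor W ≈ (U.tensor W).sum (V.tensor W) := by
  let e : ((U.sum V).tensor W).carrier ≃ ((U.tensor W).sum (V.tensor W)).carrier :=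
    { toFun := Quotient.lift (fun p : (U ⊕ V) × W => match p with
        | (.inl x, y) => Sum.inl (Quotient.mk (tensorRel U W) (x, y))
        | (.inr x, y) => Sum.inr (Quotient.mk (tensorRel V W) (x, y))) (by
          rintro ⟨x | x, y⟩ ⟨x' | x', y'⟩ ⟨a, h1, h2⟩
          · exact congrArg Sum.inl (Quotient.sound ⟨a, Sum.inl_injective h1, h2⟩)
          · cases h1
          · cases h1
          · exact congrArg Sum.inr (Quotient.sound ⟨a, Sum.inr_injective h1, h2⟩))
      invFun := Sum.elim
        (Quotient.map (fun p => (Sum.inl p.1, p.2)) (by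
          rintro p q ⟨a, h1, h2⟩
          exact ⟨a, congrArg Sum.inl h1, h2⟩))
        (Quotient.map (fun p => (Sum.inr p.1, p.2)) (by
          rintro p q ⟨a, h1, h2⟩
          exact ⟨a, congrArg Sum.inr h1, h2⟩))
      left_inv := by rintro ⟨x | x, y⟩ <;> rfl
      right_inv := by rintro (⟨x, y⟩ | ⟨x, y⟩) <;> rfl }
  refine equiv_of e ?_ ?_
  · rintro a ⟨x | x, y⟩ <;> rfl
  · rintro a ⟨x | x, y⟩ <;> rfl

lemma tensor_empty (U : FinBiset K H) : U.tensor (empty H G) ≈ empty K G := by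
  refine equiv_of ⟨fun x => Quotient.lift (fun p => p.2) ?_ x, fun x => x.elim, ?_, ?_⟩ ?_ ?_
  · rintro p; exact p.2.elim
  · rintro ⟨p⟩; exact p.2.elim
  · rintro p; exact p.elim
  · rintro a ⟨p⟩; exact p.2.elim
  · rintro a ⟨p⟩; exact p.2.elim

lemma empty_tensor (V : FinBiset H G) : (empty K H).tensor V ≈ empty K G := by
  refine equiv_of ⟨fun x => Quotient.lift (fun p => p.1) ?_ x, fun x => x.elim, ?_, ?_⟩ ?_ ?_
  · rintro p; exact p.1.elim
  · rintro ⟨p⟩; exact p.1.elim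
  · rintro p; exact p.elim
  · rintro a ⟨p⟩; exact p.1.elim
  · rintro a ⟨p⟩; exact p.1.elim

lemma id_tensor [Finite H] (V : FinBiset H G) : (id H).tensor V ≈ V := by
  let e : ((id H).tensor V).carrier ≃ V.carrier :=
    { toFun := Quotient.lift (fun p : H × V => p.1 • p.2) (by
        rintro ⟨(x : H), y⟩ ⟨(x' : H), y'⟩ ⟨a, h1, h2⟩
        change x = x' * a at h1
        change y' = a • y at h2
        change x • y = x' • y'
        rw [h1, h2, smul_smul])
      invFun := fun y => Quotient.mk (tensorRel (id H) V) ((1 : H), y)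
      left_inv := by
        rintro ⟨(x : H), y⟩
        refine Quotient.sound ⟨x⁻¹, ?_, ?_⟩
        · exact (mul_inv_cancel x).symm
        · exact (inv_smul_smul x y).symm
      right_inv := fun y => one_smul H y }
  refine equiv_of e ?_ ?_
  · rintro a ⟨(x : H), y⟩
    exact mul_smul a x y
  · rintro a ⟨(x : H), y⟩
    exact smul_comm x a y

lemma tensor_id [Finite H] (U : FinBiset K H) : U.tensor (id H) ≈ U := by
  let e : (U.tensor (id H)).carrier ≃ U.carrier :=
    { toFun := Quotient.lift (fun p : U × H => MulOpposite.op p.2 • p.1) (by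
        rintro ⟨x, (y : H)⟩ ⟨x', (y' : H)⟩ ⟨a, h1, h2⟩
        change x = MulOpposite.op a • x' at h1
        change y' = a * y at h2
        change MulOpposite.op y • x = MulOpposite.op y' • x'
        rw [h1, h2, smul_smul, MulOpposite.op_mul])
      invFun := fun x => Quotient.mk (tensorRel U (id H)) (x, (1 : H))
      left_inv := by
        rintro ⟨x, (y : H)⟩
        refine Quotient.sound ⟨y, rfl, ?_⟩
        exact (mul_one y).symm
      right_inv := fun y => one_smul Hᵐᵒᵖ y }
  refine equiv_of e ?_ ?_
  · rintro a ⟨x, (y : H)⟩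
    exact (smul_comm a (MulOpposite.op y) x).symm
  · rintro a ⟨x, (y : H)⟩
    exact mul_smul a (MulOpposite.op y) x

lemma tensor_assoc (U : FinBiset L K) (V : FinBiset K H) (W : FinBiset H G) :
    (U.tensor V).tensor W ≈ U.tensor (V.tensor W) := by
  let e : ((U.tensor V).tensor W).carrier ≃ (U.tensor (V.tensor W)).carrier :=
    { toFun := Quotient.lift (fun p : (U.tensor V).carrier × W =>
          (Quotient.map (fun q : U × V => (q.1, Quotient.mk (tensorRel V W) (q.2, p.2))) (by
            rintro q q' ⟨a, h1, h2⟩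
            refine ⟨a, h1, ?_⟩
            exact congrArg (Quotient.mk _) (Prod.ext h2 rfl)) p.1 :
            Quotient (tensorRel U (V.tensor W)))) (by
          rintro ⟨⟨x, y⟩, z⟩ ⟨⟨x', y'⟩, z'⟩ ⟨a, h1, h2⟩
          obtain ⟨b, h3, h4⟩ := Quotient.exact h1
          refine Quotient.sound ⟨b, h3, Quotient.sound ⟨a⁻¹, ?_, ?_⟩⟩
          · change y' = MulOpposite.op a⁻¹ • (b • y)
            change MulOpposite.op a • y' = b • y at h4
            rw [← h4, smul_smul, ← MulOpposite.op_mul]; simp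
          · change z = a⁻¹ • z'
            change z' = a • z at h2
            rw [h2, inv_smul_smul])
      invFun := Quotient.lift (fun p : U × (V.tensor W).carrier =>
          (Quotient.map (fun q : V × W => (Quotient.mk (tensorRel U V) (p.1, q.1), q.2)) (by
            rintro q q' ⟨a, h1, h2⟩
            refine ⟨a, ?_, h2⟩
            exact congrArg (Quotient.mk _) (Prod.ext rfl h1)) p.2 :
            Quotient (tensorRel (U.tensor V) W))) (by
          rintro ⟨x, ⟨y, z⟩⟩ ⟨x', ⟨y', z'⟩⟩ ⟨a, h1, h2⟩
          obtain ⟨b, h3, h4⟩ := Quotient.exact h2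
          refine Quotient.sound ⟨b⁻¹, Quotient.sound ⟨a, h1, ?_⟩, ?_⟩
          · change MulOpposite.op b⁻¹ • y' = a • y
            change y' = MulOpposite.op b • (a • y) at h3
            rw [h3, smul_smul, ← MulOpposite.op_mul]; simp
          · change z' = b⁻¹ • z
            change z = b • z' at h4
            rw [h4, inv_smul_smul])
      left_inv := by rintro ⟨⟨x, y⟩, z⟩; rfl
      right_inv := by rintro ⟨x, ⟨y, z⟩⟩; rfl }
  refine equiv_of e ?_ ?_
  · rintro a ⟨⟨x, y⟩, z⟩; rfl
  · rintro a ⟨⟨x, y⟩, z⟩; rfl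

end

end FinBiset

section Burnside

variable (L K H G : Type u) [Group L] [Group K] [Group H] [Group G]

/-- Isomorphism classes of finite `(H, G)`-bisets. -/
def BisetClass : Type (u + 1) := Quotient (FinBiset.setoid H G)

instance : Zero (BisetClass H G) := ⟨Quotient.mk _ (FinBiset.empty H G)⟩

instance : Add (BisetClass H G) :=
  ⟨Quotient.map₂ FinBiset.sum fun _ _ h _ _ h' => FinBiset.sum_congr h h'⟩

/-- Isomorphism classes of finite bisets form a commutative monoid under disjoint union. -/
instance : AddCommMonoid (BisetClass H G) where
  add_assoc := by rintro ⟨U⟩ ⟨V⟩ ⟨W⟩; exact Quotient.sound (FinBiset.sum_assoc' U V W)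
  add_comm := by rintro ⟨U⟩ ⟨V⟩; exact Quotient.sound (FinBiset.sum_comm' U V)
  zero_add := by rintro ⟨U⟩; exact Quotient.sound (FinBiset.empty_sum U)
  add_zero := by
    rintro ⟨U⟩
    exact Quotient.sound (Setoid.trans (FinBiset.sum_comm' _ _) (FinBiset.empty_sum U))
  nsmul := nsmulRec

/-- The product `U ×_H V` on isomorphism classes, as a biadditive map. -/
def BisetClass.tensorHom : BisetClass K H →+ BisetClass H G →+ BisetClass K G where
  toFun U :=
    { toFun := Quotient.map₂ FinBiset.tensor (fun _ _ h _ _ h' => FinBiset.tensor_congr h h') U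
      map_zero' := by
        obtain ⟨U⟩ := U
        exact Quotient.sound (FinBiset.tensor_empty U)
      map_add' := by
        obtain ⟨U⟩ := U
        rintro ⟨V⟩ ⟨W⟩
        exact Quotient.sound (FinBiset.tensor_sum U V W) }
  map_zero' := by
    ext V
    obtain ⟨V⟩ := V
    exact Quotient.sound (FinBiset.empty_tensor V)
  map_add' := by
    rintro ⟨U⟩ ⟨V⟩
    ext W
    obtain ⟨W⟩ := W
    exact Quotient.sound (FinBiset.sum_tensor U V W)

/-- The double Burnside group `B(H, G)`: the Grothendieck group of finite `(H, G)`-bisets with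
respect to disjoint union. -/
abbrev BurnsideGroup : Type (u + 1) := Algebra.GrothendieckAddGroup (BisetClass H G)

/-- The class of a finite biset in the double Burnside group. -/
def BurnsideGroup.of {H G : Type u} [Group H] [Group G] (U : FinBiset H G) : BurnsideGroup H G :=
  Algebra.GrothendieckAddGroup.of (Quotient.mk _ U : BisetClass H G)

lemma lift_of {M N : Type*} [AddCommMonoid M] [AddCommGroup N] (f : M →+ N) (x : M) :
    Algebra.GrothendieckAddGroup.lift f (Algebra.GrothendieckAddGroup.of x) = f x :=
  DFunLike.congr_fun (Algebra.GrothendieckAddGroup.lift.symm_apply_apply f) x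

lemma groth_ext {M N : Type*} [AddCommMonoid M] [AddCommGroup N]
    {f g : Algebra.GrothendieckAddGroup M →+ N}
    (h : ∀ x, f (Algebra.GrothendieckAddGroup.of x) = g (Algebra.GrothendieckAddGroup.of x)) :
    f = g :=
  Algebra.GrothendieckAddGroup.lift.symm.injective (AddMonoidHom.ext h)

/-- The biadditive extension of the product of bisets to `B(K, H) × B(H, G) → B(K, G)`. -/
def BurnsideGroup.comp : BurnsideGroup K H →+ BurnsideGroup H G →+ BurnsideGroup K G :=
  Algebra.GrothendieckAddGroup.lift
    { toFun := fun U => Algebra.GrothendieckAddGroup.lift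
        (Algebra.GrothendieckAddGroup.of.comp (BisetClass.tensorHom K H G U))
      map_zero' := groth_ext fun x => by
        rw [lift_of]
        simp
      map_add' := fun U V => groth_ext fun x => by
        rw [AddMonoidHom.add_apply, lift_of, lift_of, lift_of]
        simp }

@[simp]
lemma BurnsideGroup.comp_of (U : FinBiset K H) (V : FinBiset H G) :
    BurnsideGroup.comp K H G (of U) (of V) = of (U.tensor V) := by
  exact (DFunLike.congr_fun (lift_of _ _) (of V)).trans (lift_of _ _)

lemma BurnsideGroup.induction {p : BurnsideGroup H G → Prop} (h1 : ∀ U : FinBiset H G, p (of U))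
    (h2 : ∀ x y, p x → p y → p (x - y)) (x : BurnsideGroup H G) : p x := by
  induction x using AddLocalization.ind with
  | _ y =>
    obtain ⟨m, s, hs⟩ := y
    have : (AddLocalization.mk m ⟨s, hs⟩ : BurnsideGroup H G) =
        Algebra.GrothendieckAddGroup.of m - Algebra.GrothendieckAddGroup.of s := by
      change _ = AddLocalization.addMonoidOf ⊤ m - AddLocalization.addMonoidOf ⊤ s
      rw [← AddLocalization.mk_zero_eq_addMonoidOf_mk, ← AddLocalization.mk_zero_eq_addMonoidOf_mk,
        Algebra.GrothendieckAddGroup.mk_sub_mk]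
      congr 1
      · simp
      · ext; simp
    rw [this]
    obtain ⟨U⟩ := m
    obtain ⟨V⟩ := s
    exact h2 _ _ (h1 U) (h1 V)

variable {L K H G} in
lemma BurnsideGroup.of_eq {U V : FinBiset H G} (h : U ≈ V) : of U = of V :=
  congrArg Algebra.GrothendieckAddGroup.of (show (Quotient.mk _ U : BisetClass H G) = _ from
    Quotient.sound h)

lemma BurnsideGroup.comp_assoc (x : BurnsideGroup L K) (y : BurnsideGroup K H)
    (z : BurnsideGroup H G) :
    comp L H G (comp L K H x y) z = comp L K G x (comp K H G y z) := by
  induction x using BurnsideGroup.induction with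
  | h2 x x' h h' => simp only [map_sub, AddMonoidHom.sub_apply, h, h']
  | h1 U =>
  induction y using BurnsideGroup.induction with
  | h2 x x' h h' => simp only [map_sub, AddMonoidHom.sub_apply, h, h']
  | h1 V =>
  induction z using BurnsideGroup.induction with
  | h2 x x' h h' => simp only [map_sub, h, h']
  | h1 W =>
  simp only [comp_of]
  exact of_eq (FinBiset.tensor_assoc U V W)

lemma BurnsideGroup.id_comp [Finite H] (x : BurnsideGroup H G) :
    comp H H G (of (FinBiset.id H)) x = x := by
  induction x using BurnsideGroup.induction with
  | h2 x x' h h' => rw [map_sub, h, h']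
  | h1 U =>
  rw [comp_of]
  exact of_eq (FinBiset.id_tensor U)

lemma BurnsideGroup.comp_id [Finite G] (x : BurnsideGroup H G) :
    comp H G G x (of (FinBiset.id G)) = x := by
  induction x using BurnsideGroup.induction with
  | h2 x x' h h' => rw [map_sub, AddMonoidHom.sub_apply, h, h']
  | h1 U =>
  rw [comp_of]
  exact of_eq (FinBiset.tensor_id U)

variable (R : Type w) [CommRing R]

/-- `RB(H, G) = R ⊗ B(H, G)`. -/
abbrev RBurnside : Type (max w (u + 1)) := R ⊗[ℤ] BurnsideGroup H G

/-- The `R`-bilinear extension of the product of bisets, `RB(K, H) × RB(H, G) → RB(K, G)`. -/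
def RBurnside.comp : RBurnside K H R →ₗ[R] RBurnside H G R →ₗ[R] RBurnside K G R :=
  LinearMap.liftBaseChange R
    ((LinearMap.baseChangeHom ℤ R (BurnsideGroup H G) (BurnsideGroup K G)).comp
      ((addMonoidHomLequivInt ℤ).toLinearMap.comp (BurnsideGroup.comp K H G).toIntLinearMap))

/-- The class of a finite biset in `RB(H, G)`. -/
def RBurnside.of {H G : Type u} [Group H] [Group G] (U : FinBiset H G) : RBurnside H G R :=
  1 ⊗ₜ[ℤ] BurnsideGroup.of U

lemma RBurnside.comp_tmul (r s : R) (x : BurnsideGroup K H) (y : BurnsideGroup H G) :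
    comp K H G R (r ⊗ₜ[ℤ] x) (s ⊗ₜ[ℤ] y) = (r * s) ⊗ₜ[ℤ] BurnsideGroup.comp K H G x y := by
  change r • (s ⊗ₜ[ℤ] BurnsideGroup.comp K H G x y) = _
  rw [TensorProduct.smul_tmul', smul_eq_mul]

lemma RBurnside.comp_assoc (x : RBurnside L K R) (y : RBurnside K H R)
    (z : RBurnside H G R) :
    comp L H G R (comp L K H R x y) z = comp L K G R x (comp K H G R y z) := by
  induction x using TensorProduct.induction_on with
  | zero => simp only [map_zero, LinearMap.zero_apply]
  | add x x' h h' => simp only [map_add, LinearMap.add_apply, h, h']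
  | tmul r x =>
  induction y using TensorProduct.induction_on with
  | zero => simp only [map_zero, LinearMap.zero_apply]
  | add x x' h h' => simp only [map_add, LinearMap.add_apply, h, h']
  | tmul s y =>
  induction z using TensorProduct.induction_on with
  | zero => simp only [map_zero]
  | add x x' h h' => simp only [map_add, h, h']
  | tmul t z =>
  simp only [comp_tmul, BurnsideGroup.comp_assoc, mul_assoc]

lemma RBurnside.id_comp [Finite H] (x : RBurnside H G R) :
    comp H H G R (of R (FinBiset.id H)) x = x := by
  induction x using TensorProduct.induction_on with
  | zero => rw [map_zero]
  | add x x' h h' => rw [map_add, h, h']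
  | tmul r x => rw [of, comp_tmul, one_mul, BurnsideGroup.id_comp]

lemma RBurnside.comp_id [Finite G] (x : RBurnside H G R) :
    comp H G G R x (of R (FinBiset.id G)) = x := by
  induction x using TensorProduct.induction_on with
  | zero => simp only [map_zero, LinearMap.zero_apply]
  | add x x' h h' => rw [map_add, LinearMap.add_apply, h, h']
  | tmul r x => rw [of, comp_tmul, mul_one, BurnsideGroup.comp_id]

end Burnside

/-! ### The biset category -/

/-- The objects of the biset category `R𝒟`: the groups of the class `𝒟`. -/
structure BisetCat (R : Type w) (D : GroupClass.{u}) where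
  /-- the underlying group -/
  carrier : Type u
  [group : Group carrier]
  mem : D.Mem carrier

namespace BisetCat

variable {R : Type w} {D : GroupClass.{u}}

instance : CoeSort (BisetCat R D) (Type u) := ⟨carrier⟩

attribute [instance] group

instance (G : BisetCat R D) : Finite G := D.finite_of_mem _ G.mem

/-- A subgroup, as an object of the biset category. -/
def sub (G : BisetCat R D) (K : Subgroup G) : BisetCat R D := ⟨K, D.mem_subgroup _ K G.mem⟩

/-- A quotient group, as an object of the biset category. -/
def quot (G : BisetCat R D) (N : Subgroup G) [N.Normal] : BisetCat R D :=
  ⟨G ⧸ N, D.mem_quotient _ N G.mem⟩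

/-- A direct product, as an object of the biset category. -/
def prod (G H : BisetCat R D) : BisetCat R D := ⟨G × H, D.mem_prod _ _ G.mem H.mem⟩

variable [CommRing R]

/-- The biset category: `Hom(G, H) = RB(H, G)`, and the composite of `f : G ⟶ H` and `g : H ⟶ K` is
`g ×_H f`. -/
instance : Category.{max w (u + 1)} (BisetCat R D) where
  Hom G H := RBurnside H G R
  id G := RBurnside.of R (FinBiset.id G)
  comp {G H K} f g := RBurnside.comp K H G R g f
  id_comp _ := RBurnside.comp_id _ _ _ _
  comp_id _ := RBurnside.id_comp _ _ _ _
  assoc _ _ _ := (RBurnside.comp_assoc _ _ _ _ _ _ _ _).symm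

instance (G H : BisetCat R D) : AddCommGroup (G ⟶ H) :=
  inferInstanceAs (AddCommGroup (RBurnside H G R))

instance (G H : BisetCat R D) : Module R (G ⟶ H) :=
  inferInstanceAs (Module R (RBurnside H G R))

/-- Composition in the biset category, as a bilinear map. -/
def compHom (G H K : BisetCat R D) : (H ⟶ K) →ₗ[R] (G ⟶ H) →ₗ[R] (G ⟶ K) :=
  RBurnside.comp K H G R

instance : Preadditive (BisetCat R D) where
  homGroup G H := inferInstance
  add_comp G H K f f' g := by
    change compHom G H K g (f + f') = compHom G H K g f + compHom G H K g f'
    exact map_add (compHom G H K g) f f'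
  comp_add G H K f g g' := by
    change compHom G H K (g + g') f = compHom G H K g f + compHom G H K g' f
    exact LinearMap.map_add₂ (compHom G H K) g g' f

instance : CategoryTheory.Linear R (BisetCat R D) where
  homModule G H := inferInstance
  smul_comp G H K r f g := by
    change compHom G H K g (r • f) = r • compHom G H K g f
    exact map_smul (compHom G H K g) r f
  comp_smul G H K f r g := by
    change compHom G H K (r • g) f = r • compHom G H K g f
    exact LinearMap.map_smul₂ (compHom G H K) r g f

/-- The morphism of the biset category given by a finite `(H, G)`-biset. -/
def ofBiset {G H : BisetCat R D} (U : FinBiset H G) : G ⟶ H := RBurnside.of R U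

/-- The morphism from `G` to `K` given by the `(K, G)`-biset `G`, for a homomorphism `φ : K → G`.
It is the restriction when `φ` is the inclusion of a subgroup, and the inflation when `φ` is
the projection to a quotient, or to a factor of a direct product. -/
def pull {K G : BisetCat R D} (φ : K →* G) : G ⟶ K := ofBiset (FinBiset.pull φ)

/-- The morphism from `K` to `G` given by the `(G, K)`-biset `G`, for a homomorphism `φ : K → G`.
It is the induction when `φ` is the inclusion of a subgroup, and the deflation when `φ` is
the projection to a quotient, or to a factor of a direct product. -/
def push {K G : BisetCat R D} (φ : K →* G) : K ⟶ G := ofBiset (FinBiset.push φ)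

/-- `Res^G_K`. -/
def res (G : BisetCat R D) (K : Subgroup G) : G ⟶ G.sub K := pull (K := G.sub K) K.subtype

/-- `Def^G_{G/N}`. -/
def defl (G : BisetCat R D) (N : Subgroup G) [N.Normal] : G ⟶ G.quot N :=
  push (G := G.quot N) (QuotientGroup.mk' N)

/-- `Inf_G^{G × H}`, along the first projection. -/
def infFst (G H : BisetCat R D) : G ⟶ G.prod H := pull (K := G.prod H) (MonoidHom.fst G H)

/-- `Inf_H^{G × H}`, along the second projection. -/
def infSnd (G H : BisetCat R D) : H ⟶ G.prod H := pull (K := G.prod H) (MonoidHom.snd G H)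

/-- `Def^{G × H}_G`, along the first projection. -/
def defFst (G H : BisetCat R D) : G.prod H ⟶ G := push (K := G.prod H) (MonoidHom.fst G H)

end BisetCat

/-! ### Green biset functors -/

/-- A Green biset functor over `R𝒟`: an `R`-linear functor `A` from `R𝒟` to `R`-modules, together
with a structure of unital associative `R`-algebra on every `A(G)`, such that for every group
homomorphism `φ : K → G` the map `A(pull φ) : A(G) → A(K)` is a unital ring homomorphism, and
`A(push φ) : A(K) → A(G)` satisfies the two Frobenius identities. -/
structure GreenBisetFunctor (R : Type w) [CommRing R] (D : GroupClass.{u}) where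
  /-- the underlying biset functor -/
  toFunctor : BisetCat R D ⥤ ModuleCat.{v} R
  [additive : toFunctor.Additive]
  [linear : toFunctor.Linear R]
  /-- the bilinear product of `A(G)` -/
  mul : ∀ G, toFunctor.obj G →ₗ[R] toFunctor.obj G →ₗ[R] toFunctor.obj G
  /-- the unity of `A(G)` -/
  one : ∀ G, toFunctor.obj G
  mul_assoc : ∀ G a b c, mul G (mul G a b) c = mul G a (mul G b c)
  one_mul : ∀ G a, mul G (one G) a = a
  mul_one : ∀ G a, mul G a (one G) = a
  pull_mul : ∀ {K G : BisetCat R D} (φ : K →* G) (a b : toFunctor.obj G),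
    (toFunctor.map (BisetCat.pull φ)).hom (mul G a b) =
      mul K ((toFunctor.map (BisetCat.pull φ)).hom a) ((toFunctor.map (BisetCat.pull φ)).hom b)
  pull_one : ∀ {K G : BisetCat R D} (φ : K →* G),
    (toFunctor.map (BisetCat.pull φ)).hom (one G) = one K
  push_mul : ∀ {K G : BisetCat R D} (φ : K →* G) (a : toFunctor.obj K) (b : toFunctor.obj G),
    mul G ((toFunctor.map (BisetCat.push φ)).hom a) b =
      (toFunctor.map (BisetCat.push φ)).hom (mul K a ((toFunctor.map (BisetCat.pull φ)).hom b))
  mul_push : ∀ {K G : BisetCat R D} (φ : K →* G) (a : toFunctor.obj K) (b : toFunctor.obj G),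
    mul G b ((toFunctor.map (BisetCat.push φ)).hom a) =
      (toFunctor.map (BisetCat.push φ)).hom (mul K ((toFunctor.map (BisetCat.pull φ)).hom b) a)

namespace GreenBisetFunctor

attribute [instance] additive linear

section

variable {R : Type w} [CommRing R] {D : GroupClass.{u}} (A : GreenBisetFunctor.{u, w, v} R D)

/-- The evaluation `A(G)`, with its structure of `R`-algebra. -/
def Ev (G : BisetCat R D) : Type v := A.toFunctor.obj G

instance (G : BisetCat R D) : AddCommGroup (A.Ev G) :=
  inferInstanceAs (AddCommGroup (A.toFunctor.obj G))

instance (G : BisetCat R D) : Module R (A.Ev G) :=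
  inferInstanceAs (Module R (A.toFunctor.obj G))

instance (G : BisetCat R D) : Ring (A.Ev G) :=
  { (inferInstance : AddCommGroup (A.Ev G)) with
    mul := fun a b => A.mul G a b
    one := A.one G
    mul_assoc := A.mul_assoc G
    one_mul := A.one_mul G
    mul_one := A.mul_one G
    left_distrib := fun a b c => map_add (A.mul G a) b c
    right_distrib := fun a b c => LinearMap.map_add₂ (A.mul G) a b c
    zero_mul := fun a => LinearMap.map_zero₂ (A.mul G) a
    mul_zero := fun a => map_zero (A.mul G a) }

instance (G : BisetCat R D) : Algebra R (A.Ev G) :=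
  Algebra.ofModule (fun r a b => (LinearMap.map_smul₂ (A.mul G) r a b :))
    (fun r a b => (map_smul (A.mul G a) r b :))

/-- The linear map `A(f) : A(G) → A(H)`, for a morphism `f` of the biset category. -/
def map {G H : BisetCat R D} (f : G ⟶ H) : A.Ev G →ₗ[R] A.Ev H := (A.toFunctor.map f).hom

/-- The product `A(G) × A(H) → A(G × H)`, `a × b = A(Inf_G^{G × H})(a) ⬝ A(Inf_H^{G × H})(b)`. -/
def cross {G H : BisetCat R D} (a : A.Ev G) (b : A.Ev H) : A.Ev (G.prod H) :=
  A.map (G.infFst H) a * A.map (G.infSnd H) b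

/-- A (two-sided) ideal of `A`: a biset subfunctor `I` of `A` such that `a × b` lies in `I(G × H)` as
soon as `a ∈ I(G)` or `b ∈ I(H)`. -/
@[ext]
structure Ideal where
  /-- the submodule `I(G)` of `A(G)` -/
  ev : ∀ G : BisetCat R D, Submodule R (A.Ev G)
  map_mem : ∀ {G H : BisetCat R D} (f : G ⟶ H) {a : A.Ev G}, a ∈ ev G → A.map f a ∈ ev H
  cross_mem_left : ∀ {G H : BisetCat R D} (a : A.Ev G) {b : A.Ev H},
    b ∈ ev H → A.cross a b ∈ ev (G.prod H)
  cross_mem_right : ∀ {G H : BisetCat R D} {a : A.Ev G} (b : A.Ev H),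
    a ∈ ev G → A.cross a b ∈ ev (G.prod H)

variable {A}

namespace Ideal

/-- Ideals are ordered by inclusion of subfunctors. -/
instance : PartialOrder A.Ideal := PartialOrder.lift ev fun _ _ => Ideal.ext

/-- The ideal generated by `x ∈ A(G)`: the intersection of all ideals `I` with `x ∈ I(G)`. -/
def gen {G : BisetCat R D} (x : A.Ev G) : A.Ideal where
  ev H := ⨅ I : {I : A.Ideal // x ∈ I.ev G}, I.1.ev H
  map_mem f a ha := by
    simp only [Submodule.mem_iInf] at ha ⊢
    exact fun I => I.1.map_mem f (ha I)
  cross_mem_left a b hb := by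
    simp only [Submodule.mem_iInf] at hb ⊢
    exact fun I => I.1.cross_mem_left a (hb I)
  cross_mem_right b ha := by
    simp only [Submodule.mem_iInf] at ha ⊢
    exact fun I => I.1.cross_mem_right b (ha I)

/-- The sum of a family of ideals, `(∑ I_j)(G) = ∑ I_j(G)`. -/
def sum {ι : Type*} (I : ι → A.Ideal) : A.Ideal where
  ev G := ⨆ j, (I j).ev G
  map_mem {G H} f a ha := by
    suffices h : (⨆ j, (I j).ev G) ≤ (⨆ j, (I j).ev H).comap (A.map f) from h ha
    exact iSup_le fun j x hx => Submodule.mem_iSup_of_mem j ((I j).map_mem f hx)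
  cross_mem_left {G H} a b hb := by
    let F : A.Ev H →ₗ[R] A.Ev (G.prod H) :=
      (LinearMap.mulLeft R (A.map (G.infFst H) a)).comp (A.map (G.infSnd H))
    suffices h : (⨆ j, (I j).ev H) ≤ (⨆ j, (I j).ev (G.prod H)).comap F from h hb
    exact iSup_le fun j x hx => Submodule.mem_iSup_of_mem j ((I j).cross_mem_left a hx)
  cross_mem_right {G H} a b ha := by
    let F : A.Ev G →ₗ[R] A.Ev (G.prod H) :=
      (LinearMap.mulRight R (A.map (G.infSnd H) b)).comp (A.map (G.infFst H))
    suffices h : (⨆ j, (I j).ev G) ≤ (⨆ j, (I j).ev (G.prod H)).comap F from h ha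
    exact iSup_le fun j x hx => Submodule.mem_iSup_of_mem j ((I j).cross_mem_right b hx)

end Ideal

end

end GreenBisetFunctor

/-! ### Split semisimple algebras and primitive idempotents -/

/-- A finite-dimensional split semisimple `𝕂`-algebra: a finite product of full matrix algebras
over `𝕂`. -/
def IsSplitSemisimple (𝕂 S : Type*) [Field 𝕂] [Ring S] [Algebra 𝕂 S] : Prop :=
  ∃ (k : ℕ) (n : Fin k → ℕ), (∀ i, n i ≠ 0) ∧
    Nonempty (S ≃ₐ[𝕂] ((i : Fin k) → Matrix (Fin (n i)) (Fin (n i)) 𝕂))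

/-- A primitive idempotent: a non-zero idempotent which is not the sum of two non-zero orthogonal
idempotents. -/
structure IsPrimitiveIdempotent {S : Type*} [Ring S] (e : S) : Prop where
  idem : IsIdempotentElem e
  ne_zero : e ≠ 0
  eq_zero_or : ∀ f g : S, IsIdempotentElem f → IsIdempotentElem g → f * g = 0 → g * f = 0 →
    e = f + g → f = 0 ∨ g = 0

namespace GreenBisetFunctor

variable {𝕂 : Type w} [Field 𝕂] {D : GroupClass.{u}} (A : GreenBisetFunctor.{u, w, v} 𝕂 D)

/-- `E_G`, the set of primitive idempotents of `A(G)`. -/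
def E (G : BisetCat 𝕂 D) : Set (A.Ev G) := {e | IsPrimitiveIdempotent e}

/-- The set of `e ∈ E_H` with `A(Res^H_K)(e) = 0` for every proper subgroup `K` of `H`. -/
def ERes (H : BisetCat 𝕂 D) : Set (A.Ev H) :=
  {e | e ∈ A.E H ∧ ∀ K : Subgroup H, K < ⊤ → A.map (H.res K) e = 0}

/-- The set of `e ∈ E_H` with `A(Def^H_{H/N})(e) = 0` for every non-trivial normal subgroup `N`. -/
def EDef (H : BisetCat 𝕂 D) : Set (A.Ev H) :=
  {e | e ∈ A.E H ∧ ∀ (N : Subgroup H) [N.Normal], N ≠ ⊥ → A.map (H.defl N) e = 0}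

/-- `H` is an `MC`-group of `A`. -/
def IsMCGroup (H : BisetCat 𝕂 D) : Prop := (A.ERes H ∩ A.EDef H).Nonempty

/-- The class `ℳ` of pairs `(H, e_H)`, where `H` is an `MC`-group of `A` and `e_H` lies in the
intersection of `ERes H` and `EDef H`. -/
structure MCPair where
  /-- the group `H` -/
  grp : BisetCat 𝕂 D
  isMCGroup : A.IsMCGroup grp
  /-- the idempotent `e_H` -/
  e : A.Ev grp
  e_mem : e ∈ A.ERes grp ∩ A.EDef grp

namespace MCPair

variable {A}

/-- The relation `(H, e_H) ≫ (K, e_K)`: there is `x ∈ E_{H × K}` with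
`e_H ⬝ A(Def^{H × K}_H)(x ⬝ A(Inf_K^{H × K})(e_K)) ≠ 0`. -/
def Dominates (p q : A.MCPair) : Prop :=
  ∃ x ∈ A.E (p.grp.prod q.grp),
    p.e * A.map (p.grp.defFst q.grp) (x * A.map (p.grp.infSnd q.grp) q.e) ≠ 0

/-- Once `≫` is known to be a preorder, `ℳ` is ordered by `q ≤ p` iff `p ≫ q`. -/
instance [IsPreorder A.MCPair Dominates] : Preorder A.MCPair where
  le q p := Dominates p q
  le_refl p := refl_of (r := Dominates) p
  le_trans _ _ _ h h' := trans_of (r := Dominates) h' h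

end MCPair

/-- The set `[ℳ]` of equivalence classes of `ℳ`, for the relation `p ≫ q` and `q ≫ p`. It is
partially ordered by `[q] ≤ [p]` iff `p ≫ q`. -/
abbrev MCClass [IsPreorder A.MCPair MCPair.Dominates] : Type _ :=
  Antisymmetrization A.MCPair (· ≤ ·)

variable {A} in
/-- The class `[H, e_H]`. -/
abbrev MCPair.cls [IsPreorder A.MCPair MCPair.Dominates] (p : A.MCPair) : A.MCClass :=
  toAntisymmetrization (· ≤ ·) p

end GreenBisetFunctor

end GreenBiset

end

open GreenBiset

/-! Everything rests on reading `≫` as reverse size of principal ideals: `p ≫ q` exactly when `gen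
p.e ≤ gen q.e` (`MCPair.dominates_iff`). This makes `≫` a preorder at once, and shows that `p.e ∈ I`
depends only on the class of `p` and defines a closed set.

Each `A(G)` is a finite product of copies of `𝕂`, so a primitive idempotent `e` satisfies `e * a ∈ 𝕂
e`. Hence an element `a` of an ideal `I` forces every primitive `e` with `e * a ≠ 0` into `I`, and
those `e` span `a`: an ideal is determined by its primitive idempotents. For the same reason a
primitive idempotent in a sum of ideals lies in one of the summands (`Ideal.mem_sum_iff`), which
gives the inverse map.

It remains to see that every primitive idempotent generates the same ideal as some member of `ℳ`
(`exists_mcPair_gen_eq`). If a restriction to a proper subgroup, or a deflation to a proper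
quotient, of `e` is non-zero, then some primitive idempotent of the smaller group generates the same
ideal, and induction on the order finishes. For deflation this is one Frobenius identity. For
restriction it needs characteristic zero: `Res Ind 1` must not be a zero divisor
(`mul_pull_push_one_ne_zero`), because a Mackey decomposition exhibits a positive integer multiple
of a non-zero element.

The description of `≫` uses the formula `gen e (H) = {Def (x * Inf e)}` (`gen_ev_eq_range`). Its
proof needs stability under pullbacks and pushforwards only, since every biset is a disjoint union
of bisets `H ×_L G`. -/

namespace GreenBiset

/-! ### Composites of pullback and pushforward bisets -/

namespace FinBiset

variable {K H G L : Type u} [Group K] [Group H] [Group G] [Group L]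

/-- The restriction of the left action of a biset along a group homomorphism. -/
def resLeft (φ : K →* H) (V : FinBiset H G) : FinBiset K G :=
  ofActions V (fun k x => φ k • x) (fun x g => MulOpposite.op g • x) (by simp)
    (by simp [mul_smul]) (by simp) (by simp [mul_smul]) (fun a x b => (smul_comm _ _ _).symm)

/-- The restriction of the right action of a biset along a group homomorphism. -/
def resRight (U : FinBiset K G) (φ : H →* G) : FinBiset K H :=
  ofActions U (fun k x => k • x) (fun x g => MulOpposite.op (φ g) • x) (by simp)
    (by simp [mul_smul]) (by simp) (by simp [mul_smul]) (fun a x b => (smul_comm _ _ _).symm)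

/-- Since `[x, v] = [1, x • v]`, every class has exactly one representative with first coordinate
`1`. The mirror argument gives `tensor_push`. -/
lemma pull_tensor [Finite H] (φ : K →* H) (V : FinBiset H G) :
    (pull φ).tensor V ≈ resLeft φ V := by
  let e : ((pull φ).tensor V).carrier ≃ V.carrier :=
    { toFun := Quotient.lift (fun p : H × V => p.1 • p.2) (by
        rintro ⟨(x : H), y⟩ ⟨(x' : H), y'⟩ ⟨a, h1, h2⟩
        change x = x' * a at h1
        change y' = a • y at h2
        change x • y = x' • y'
        rw [h1, h2, smul_smul])
      invFun := fun y => Quotient.mk (tensorRel (pull φ) V) ((1 : H), y)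
      left_inv := by
        rintro ⟨(x : H), y⟩
        refine Quotient.sound ⟨x⁻¹, ?_, ?_⟩
        · exact (mul_inv_cancel x).symm
        · exact (inv_smul_smul x y).symm
      right_inv := fun y => one_smul H y }
  refine equiv_of e ?_ ?_
  · rintro a ⟨(x : H), y⟩
    exact mul_smul (φ a) x y
  · rintro a ⟨(x : H), y⟩
    exact smul_comm x a y

lemma tensor_push [Finite G] (U : FinBiset K G) (φ : H →* G) :
    U.tensor (push φ) ≈ resRight U φ := by
  let e : (U.tensor (push φ)).carrier ≃ U.carrier :=
    { toFun := Quotient.lift (fun p : U × G => MulOpposite.op p.2 • p.1) (by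
        rintro ⟨x, (y : G)⟩ ⟨x', (y' : G)⟩ ⟨a, h1, h2⟩
        change x = MulOpposite.op a • x' at h1
        change y' = a * y at h2
        change MulOpposite.op y • x = MulOpposite.op y' • x'
        rw [h1, h2, smul_smul, MulOpposite.op_mul])
      invFun := fun x => Quotient.mk (tensorRel U (push φ)) (x, (1 : G))
      left_inv := by
        rintro ⟨x, (y : G)⟩
        refine Quotient.sound ⟨y, rfl, ?_⟩
        exact (mul_one y).symm
      right_inv := fun y => one_smul Gᵐᵒᵖ y }
  refine equiv_of e ?_ ?_
  · rintro a ⟨x, (y : G)⟩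
    exact (smul_comm a (MulOpposite.op y) x).symm
  · rintro a ⟨x, (y : G)⟩
    exact mul_smul (MulOpposite.op (φ a.unop)) (MulOpposite.op y) x

lemma pull_tensor_pull [Finite G] [Finite H] (φ : K →* H) (ψ : H →* G) :
    (pull φ).tensor (pull ψ) ≈ pull (ψ.comp φ) :=
  Setoid.trans (pull_tensor φ (pull ψ))
    (equiv_of (Equiv.refl G) (fun _ _ => rfl) (fun _ _ => rfl))

lemma push_tensor_push [Finite G] [Finite H] (φ : K →* H) (ψ : H →* G) :
    (push ψ).tensor (push φ) ≈ push (ψ.comp φ) :=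
  Setoid.trans (tensor_push (push ψ) φ)
    (equiv_of (Equiv.refl G) (fun _ _ => rfl) (fun _ _ => rfl))

lemma pull_id [Finite G] : pull (MonoidHom.id G) ≈ id G :=
  equiv_of (Equiv.refl G) (fun _ _ => rfl) (fun _ _ => rfl)

lemma push_id [Finite G] : push (MonoidHom.id G) ≈ id G :=
  equiv_of (Equiv.refl G) (fun _ _ => rfl) (fun _ _ => rfl)

/-- A deflation after the corresponding inflation is the identity. -/
lemma push_tensor_pull_of_surjective [Finite G] {φ : K →* G} (hφ : Function.Surjective φ) :
    (push φ).tensor (pull φ) ≈ id G := by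
  let e : ((push φ).tensor (pull φ)).carrier ≃ G :=
    { toFun := Quotient.lift (fun p : G × G => p.1 * p.2) (by
        rintro ⟨(x : G), (y : G)⟩ ⟨(x' : G), (y' : G)⟩ ⟨a, h1, h2⟩
        change x = x' * φ a at h1
        change y' = φ a * y at h2
        change x * y = x' * y'
        rw [h1, h2, mul_assoc])
      invFun := fun y => Quotient.mk (tensorRel (push φ) (pull φ)) ((1 : G), y)
      left_inv := by
        rintro ⟨(x : G), (y : G)⟩
        -- Surjectivity lets the whole left coordinate be moved across the tensor sign.
        obtain ⟨k, rfl⟩ := hφ x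
        refine Quotient.sound ⟨k⁻¹, ?_, ?_⟩
        · change 1 = φ k * φ k⁻¹
          simp
        · change y = φ k⁻¹ * (φ k * y)
          simp
      right_inv := fun y => one_mul y }
  refine equiv_of e ?_ ?_
  · rintro a ⟨(x : G), (y : G)⟩
    exact mul_assoc a x y
  · rintro a ⟨(x : G), (y : G)⟩
    exact (mul_assoc x y a.unop).symm

/-- The Mackey formula for the projection `H × K → H` and a homomorphism `φ : L → H`. -/
lemma pull_tensor_push_fst [Finite H] [Finite L] [Finite K] (φ : L →* H) :
    (pull φ).tensor (push (MonoidHom.fst H K)) ≈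
      (push (MonoidHom.fst L K)).tensor (pull (φ.prodMap (MonoidHom.id K))) := by
  refine Setoid.trans (pull_tensor φ _) (Setoid.symm ?_)
  let e : ((push (MonoidHom.fst L K)).tensor (pull (φ.prodMap (MonoidHom.id K)))).carrier ≃ H :=
    { toFun := Quotient.lift (fun p : L × (H × K) => φ p.1 * p.2.1) (by
        rintro ⟨(x : L), (y : H × K)⟩ ⟨(x' : L), (y' : H × K)⟩ ⟨a, h1, h2⟩
        change x = x' * a.1 at h1
        replace h2 : y'.1 = φ a.1 * y.1 := congrArg Prod.fst h2
        change φ x * y.1 = φ x' * y'.1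
        rw [h1, h2, map_mul, mul_assoc])
      invFun := fun y => Quotient.mk (tensorRel (push (MonoidHom.fst L K))
        (pull (φ.prodMap (MonoidHom.id K)))) ((1 : L), ((y, 1) : H × K))
      left_inv := by
        rintro ⟨(x : L), (y : H × K)⟩
        -- The tensor product is over `L × K`: `x⁻¹` brings the left coordinate to `1`, and `y.2`
        -- absorbs the `K`-coordinate.
        refine Quotient.sound ⟨(x⁻¹, y.2), ?_, ?_⟩
        · change 1 = x * x⁻¹
          simp
        · change y = (φ x⁻¹ * (φ x * y.1), y.2 * 1)
          simp
      right_inv := fun y => by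
        change φ 1 * y = y
        simp }
  refine equiv_of e ?_ ?_
  · rintro a ⟨(x : L), (y : H × K)⟩
    change φ (a * x) * y.1 = φ a * (φ x * y.1)
    rw [map_mul, mul_assoc]
  · rintro a ⟨(x : L), (y : H × K)⟩
    exact (mul_assoc (φ x) y.1 a.unop.1).symm

/-! ### Orbit decomposition of finite bisets -/

/-- The sub-biset on a subset which is stable under both actions. -/
def restrict (U : FinBiset H G) (p : U → Prop) (hl : ∀ (h : H) x, p x → p (h • x))
    (hr : ∀ (g : G) x, p x → p (MulOpposite.op g • x)) : FinBiset H G :=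
  ofActions {x // p x} (fun h x => ⟨h • x.1, hl h _ x.2⟩)
    (fun x g => ⟨MulOpposite.op g • x.1, hr g _ x.2⟩) (by simp) (by simp [mul_smul])
    (by simp) (by simp [mul_smul]) (fun a x b => Subtype.ext (smul_comm _ _ _).symm)

lemma restrict_sum_restrict_not (U : FinBiset H G) (p : U → Prop)
    (hl : ∀ (h : H) x, p x → p (h • x)) (hr : ∀ (g : G) x, p x → p (MulOpposite.op g • x))
    (hl' : ∀ (h : H) x, ¬ p x → ¬ p (h • x))
    (hr' : ∀ (g : G) x, ¬ p x → ¬ p (MulOpposite.op g • x)) :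
    (U.restrict p hl hr).sum (U.restrict (fun x => ¬ p x) hl' hr') ≈ U := by
  classical
  refine equiv_of (Equiv.sumCompl p) ?_ ?_
  · rintro a (x | x) <;> rfl
  · rintro a (x | x) <;> rfl

/-- The stabilizer in `H × G` of a point of an `(H, G)`-biset. -/
def stab (U : FinBiset H G) (u : U) : Subgroup (H × G) where
  carrier := {p : H × G | p.1 • u = MulOpposite.op p.2 • u}
  one_mem' := by simp
  mul_mem' {a b} ha hb := by
    simp only [Set.mem_ofPred_eq, Prod.fst_mul, Prod.snd_mul, MulOpposite.op_mul, mul_smul] at *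
    rw [hb, smul_comm, ha]
  inv_mem' {a} ha := by
    simp only [Set.mem_ofPred_eq, Prod.fst_inv, Prod.snd_inv, MulOpposite.op_inv] at *
    rw [inv_smul_eq_iff, smul_comm, ha, inv_smul_smul]

/-- The orbit map is `[x, y] ↦ x u y`. One has `x u y = x' u y'` exactly when `(x'⁻¹ x, y' y⁻¹)`
lies in `U.stab u`, and this is the relation defining the tensor product over the stabilizer. -/
lemma orbit_equiv [Finite H] [Finite G] (U : FinBiset H G) (u : U) (hl hr) :
    (push ((MonoidHom.fst H G).comp (U.stab u).subtype)).tensor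
      (pull ((MonoidHom.snd H G).comp (U.stab u).subtype)) ≈
    U.restrict (fun x => ∃ (h : H) (g : G), x = h • MulOpposite.op g • u) hl hr := by
  let α := (MonoidHom.fst H G).comp (U.stab u).subtype
  let β := (MonoidHom.snd H G).comp (U.stab u).subtype
  let f : ((push α).tensor (pull β)).carrier →
      {x : U // ∃ (h : H) (g : G), x = h • MulOpposite.op g • u} :=
    Quotient.lift (fun p : H × G => ⟨p.1 • MulOpposite.op p.2 • u, p.1, p.2, rfl⟩) (by
      rintro ⟨(x : H), (y : G)⟩ ⟨(x' : H), (y' : G)⟩ ⟨⟨⟨a, b⟩, hab⟩, h1, h2⟩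
      change x = x' * a at h1
      change y' = b * y at h2
      refine Subtype.ext ?_
      change x • MulOpposite.op y • u = x' • MulOpposite.op y' • u
      change a • u = MulOpposite.op b • u at hab
      rw [h1, h2, mul_smul, MulOpposite.op_mul, mul_smul, ← hab, smul_comm a])
  have hf : Function.Bijective f := by
    constructor
    · rintro ⟨(x : H), (y : G)⟩ ⟨(x' : H), (y' : G)⟩ h
      replace h : x • MulOpposite.op y • u = x' • MulOpposite.op y' • u := congrArg Subtype.val h
      refine Quotient.sound ⟨⟨(x'⁻¹ * x, y' * y⁻¹), ?_⟩, ?_, ?_⟩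
      · change (x'⁻¹ * x) • u = MulOpposite.op (y' * y⁻¹) • u
        rw [mul_smul, inv_smul_eq_iff, MulOpposite.op_mul, mul_smul, smul_comm x', ← h,
          smul_comm x, smul_smul, ← MulOpposite.op_mul]
        simp
      · change x = x' * (x'⁻¹ * x)
        simp
      · change y' = y' * y⁻¹ * y
        simp
    · rintro ⟨_, x, y, rfl⟩
      exact ⟨Quotient.mk _ (x, y), rfl⟩
  refine equiv_of (Equiv.ofBijective f hf) ?_ ?_
  · rintro a ⟨(x : H), (y : G)⟩
    exact Subtype.ext (mul_smul a x _)
  · rintro a ⟨(x : H), (y : G)⟩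
    refine Subtype.ext ?_
    change x • MulOpposite.op (y * a.unop) • u = MulOpposite.op a.unop • x • MulOpposite.op y • u
    rw [MulOpposite.op_mul, mul_smul, smul_comm x]

/-- Every finite biset is a disjoint union of bisets `H ×_L G`, where `L` is a subgroup of
`H × G`. -/
theorem induction_transitive [Finite H] [Finite G] {P : FinBiset H G → Prop}
    (iso : ∀ {U V}, U ≈ V → P U → P V) (hempty : P (empty H G))
    (hsum : ∀ U V, P U → P V → P (U.sum V))
    (htrans : ∀ L : Subgroup (H × G), P ((push ((MonoidHom.fst H G).comp L.subtype)).tensor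
      (pull ((MonoidHom.snd H G).comp L.subtype)))) (U : FinBiset H G) : P U := by
  induction hn : Nat.card U using Nat.strong_induction_on generalizing U with
  | _ n ih =>
  rcases isEmpty_or_nonempty U.carrier with h | ⟨⟨u⟩⟩
  · exact iso (equiv_of (Equiv.equivOfIsEmpty PEmpty U.carrier)
      (fun _ (x : PEmpty) => x.elim) (fun _ (x : PEmpty) => x.elim)) hempty
  let p : U → Prop := fun x => ∃ (h : H) (g : G), x = h • MulOpposite.op g • u
  have hl : ∀ (h : H) x, p x → p (h • x) := by
    rintro h _ ⟨a, b, rfl⟩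
    exact ⟨h * a, b, (mul_smul _ _ _).symm⟩
  have hr : ∀ (g : G) x, p x → p (MulOpposite.op g • x) := by
    rintro g _ ⟨a, b, rfl⟩
    exact ⟨a, b * g, by rw [MulOpposite.op_mul, mul_smul, smul_comm a (MulOpposite.op g)]⟩
  have hl' : ∀ (h : H) x, ¬ p x → ¬ p (h • x) := fun h x hx hp => hx (by
    simpa using hl h⁻¹ _ hp)
  have hr' : ∀ (g : G) x, ¬ p x → ¬ p (MulOpposite.op g • x) := fun g x hx hp => hx (by
    simpa using hr g⁻¹ _ hp)
  -- Split off the orbit of `u`; the complement omits `u`, so it is strictly smaller.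
  refine iso (restrict_sum_restrict_not U p hl hr hl' hr') (hsum _ _ ?_ ?_)
  · exact iso (orbit_equiv U u hl hr) (htrans _)
  · refine ih _ ?_ _ rfl
    rw [← hn]
    exact Finite.card_subtype_lt (p := fun x => ¬ p x) (x := u)
      (fun h => h ⟨1, 1, by simp⟩)

end FinBiset

/-! ### Relations between pullbacks and pushforwards in the biset category -/

namespace BisetCat

variable {R : Type w} {D : GroupClass.{u}}

/-- Every finite biset between groups of the class is a disjoint union of bisets of the form
`H ×_L G`, for homomorphisms `H ← L → G` of groups of the class. -/
theorem biset_induction {G H : BisetCat R D} {P : FinBiset H G → Prop}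
    (iso : ∀ {U V}, U ≈ V → P U → P V) (hempty : P (FinBiset.empty H G))
    (hsum : ∀ U V, P U → P V → P (U.sum V))
    (htrans : ∀ (L : BisetCat R D) (α : L →* H) (β : L →* G),
      P ((FinBiset.push α).tensor (FinBiset.pull β))) (U : FinBiset H G) : P U :=
  FinBiset.induction_transitive iso hempty hsum (fun L => htrans ((H.prod G).sub L) _ _) U

variable [CommRing R]

lemma ofBiset_comp {G H K : BisetCat R D} (U : FinBiset H G) (V : FinBiset K H) :
    (ofBiset U : G ⟶ H) ≫ (ofBiset V : H ⟶ K) = ofBiset (V.tensor U) := by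
  change RBurnside.comp K H G R (RBurnside.of R V) (RBurnside.of R U) = RBurnside.of R (V.tensor U)
  rw [RBurnside.of, RBurnside.of, RBurnside.comp_tmul, BurnsideGroup.comp_of, mul_one]
  rfl

lemma ofBiset_eq {G H : BisetCat R D} {U V : FinBiset H G} (h : U ≈ V) :
    (ofBiset U : G ⟶ H) = ofBiset V :=
  congrArg (fun x : BurnsideGroup H G => (1 : R) ⊗ₜ[ℤ] x) (BurnsideGroup.of_eq h)

lemma ofBiset_sum {G H : BisetCat R D} (U V : FinBiset H G) :
    (ofBiset (U.sum V) : G ⟶ H) = ofBiset U + ofBiset V := by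
  have h : BurnsideGroup.of (U.sum V) = BurnsideGroup.of U + BurnsideGroup.of V :=
    letI u : BisetClass H G := Quotient.mk _ U
    letI v : BisetClass H G := Quotient.mk _ V
    map_add (Algebra.GrothendieckAddGroup.of (M := BisetClass H G)) u v
  change (1 : R) ⊗ₜ[ℤ] BurnsideGroup.of (U.sum V) = _
  rw [h, TensorProduct.tmul_add]
  rfl

lemma ofBiset_empty {G H : BisetCat R D} :
    (ofBiset (FinBiset.empty H G) : G ⟶ H) = 0 := by
  have h : BurnsideGroup.of (FinBiset.empty H G) = 0 :=
    map_zero (Algebra.GrothendieckAddGroup.of (M := BisetClass H G))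
  change (1 : R) ⊗ₜ[ℤ] BurnsideGroup.of (FinBiset.empty H G) = _
  rw [h, TensorProduct.tmul_zero]

lemma pull_comp_pull {G H K : BisetCat R D} (φ : K →* H) (ψ : H →* G) :
    (pull ψ : G ⟶ H) ≫ (pull φ : H ⟶ K) = pull (ψ.comp φ) :=
  (ofBiset_comp _ _).trans (ofBiset_eq (FinBiset.pull_tensor_pull φ ψ))

lemma push_comp_push {G H K : BisetCat R D} (φ : K →* H) (ψ : H →* G) :
    (push φ : K ⟶ H) ≫ (push ψ : H ⟶ G) = push (ψ.comp φ) :=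
  (ofBiset_comp _ _).trans (ofBiset_eq (FinBiset.push_tensor_push φ ψ))

lemma pull_id (G : BisetCat R D) : (pull (MonoidHom.id G) : G ⟶ G) = 𝟙 G :=
  ofBiset_eq FinBiset.pull_id

lemma push_id (G : BisetCat R D) : (push (MonoidHom.id G) : G ⟶ G) = 𝟙 G :=
  ofBiset_eq FinBiset.push_id

lemma pull_comp_push_of_surjective {G K : BisetCat R D} {φ : K →* G}
    (hφ : Function.Surjective φ) : (pull φ : G ⟶ K) ≫ (push φ : K ⟶ G) = 𝟙 G :=
  (ofBiset_comp _ _).trans (ofBiset_eq (FinBiset.push_tensor_pull_of_surjective hφ))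

/-- The homomorphism `φ × id`, between products in the biset category. -/
def prodMapId {L H : BisetCat R D} (φ : L →* H) (K : BisetCat R D) : L.prod K →* H.prod K :=
  φ.prodMap (MonoidHom.id K)

/-- With the two lemmas that follow, this makes the elements `Def (x * Inf e)` stable under `pull φ`
and `push φ`: the map is absorbed into `x` through `φ × id`, which leaves the factor `K` carrying
`e` untouched. -/
lemma defFst_comp_pull {L H K : BisetCat R D} (φ : L →* H) :
    defFst H K ≫ (pull φ : H ⟶ L) = pull (prodMapId φ K) ≫ defFst L K :=
  (ofBiset_comp _ _).trans <| (ofBiset_eq (FinBiset.pull_tensor_push_fst φ)).trans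
    (ofBiset_comp (R := R) (G := H.prod K) (H := L.prod K) (K := L) _ _).symm

lemma defFst_comp_push {L H K : BisetCat R D} (φ : L →* H) :
    defFst L K ≫ (push φ : L ⟶ H) = push (prodMapId φ K) ≫ defFst H K :=
  (push_comp_push (K := L.prod K) _ _).trans
    (push_comp_push (K := L.prod K) (H := H.prod K) (prodMapId φ K) (MonoidHom.fst H K)).symm

lemma infSnd_comp_pull {L H K : BisetCat R D} (φ : L →* H) :
    infSnd H K ≫ pull (prodMapId φ K) = infSnd L K :=
  pull_comp_pull (K := L.prod K) (H := H.prod K) _ _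

/-- The diagonal homomorphism, into the product of the biset category. -/
def diag (G : BisetCat R D) : G →* G.prod G := (MonoidHom.id G).prod (MonoidHom.id G)

lemma infFst_comp_pull_diag (G : BisetCat R D) : infFst G G ≫ pull G.diag = 𝟙 G :=
  (pull_comp_pull (H := G.prod G) _ _).trans (pull_id G)

lemma infSnd_comp_pull_diag (G : BisetCat R D) : infSnd G G ≫ pull G.diag = 𝟙 G :=
  (pull_comp_pull (H := G.prod G) _ _).trans (pull_id G)

lemma push_diag_comp_defFst (G : BisetCat R D) : push G.diag ≫ defFst G G = 𝟙 G :=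
  (push_comp_push (H := G.prod G) _ _).trans (push_id G)

/-- A property of morphisms which is compatible with the linear structure and with composition holds
as soon as it holds for the morphisms `pull φ` and `push φ`. -/
theorem hom_induction {P : ∀ {G H : BisetCat R D}, (G ⟶ H) → Prop}
    (pull : ∀ {K G : BisetCat R D} (φ : K →* G), P (pull φ))
    (push : ∀ {K G : BisetCat R D} (φ : K →* G), P (push φ))
    (comp : ∀ {G H K : BisetCat R D} (f : G ⟶ H) (g : H ⟶ K), P f → P g → P (f ≫ g))
    (zero : ∀ {G H : BisetCat R D}, P (0 : G ⟶ H))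
    (add : ∀ {G H : BisetCat R D} (f g : G ⟶ H), P f → P g → P (f + g))
    (smul : ∀ {G H : BisetCat R D} (r : R) (f : G ⟶ H), P f → P (r • f))
    {G H : BisetCat R D} (f : G ⟶ H) : P f := by
  have key (U : FinBiset H G) : P (ofBiset U : G ⟶ H) := by
    refine biset_induction (R := R) (D := D) (P := fun U => P (ofBiset U : G ⟶ H))
      (fun h hU => ?_) ?_ (fun U V hU hV => ?_) (fun L α β => ?_) U
    · rwa [← ofBiset_eq h]
    · rw [ofBiset_empty]
      exact zero
    · rw [ofBiset_sum]
      exact add _ _ hU hV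
    -- The biset `H ×_L G` is `pull β` followed by `push α`.
    · rw [← ofBiset_comp (H := L)]
      exact comp _ _ (pull β) (push α)
  change RBurnside H G R at f
  induction f using TensorProduct.induction_on with
  | zero => exact zero
  | add f g hf hg => exact add _ _ hf hg
  | tmul r x =>
    have hr : r ⊗ₜ[ℤ] x = r • ((1 : R) ⊗ₜ[ℤ] x) := by
      rw [TensorProduct.smul_tmul', smul_eq_mul, mul_one]
    rw [hr]
    refine smul r (G := G) (H := H) _ ?_
    induction x using BurnsideGroup.induction with
    | h1 U => exact key U
    | h2 x y hx hy =>
      -- Virtual bisets are reached through the scalar `-1`, because the assumptions on `P` speak of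
      -- sums and scalar multiples only.
      have hxy : (1 : R) ⊗ₜ[ℤ] (x - y) = (1 : R) ⊗ₜ[ℤ] x + (-1 : R) • ((1 : R) ⊗ₜ[ℤ] y) := by
        rw [TensorProduct.tmul_sub, neg_one_smul, sub_eq_add_neg]
      rw [hxy]
      exact add (G := G) (H := H) _ _ (hx (by rw [TensorProduct.smul_tmul', smul_eq_mul, mul_one]))
        (smul (G := G) (H := H) _ _ (hy (by rw [TensorProduct.smul_tmul', smul_eq_mul, mul_one])))

end BisetCat

/-! ### Ideals of a Green biset functor -/

namespace GreenBisetFunctor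

section

variable {R : Type w} [CommRing R] {D : GroupClass.{u}} (A : GreenBisetFunctor.{u, w, v} R D)

lemma map_comp {G H K : BisetCat R D} (f : G ⟶ H) (g : H ⟶ K) (a : A.Ev G) :
    A.map (f ≫ g) a = A.map g (A.map f a) := by
  simp [map]
  rfl

lemma map_id (G : BisetCat R D) (a : A.Ev G) : A.map (𝟙 G) a = a := by
  simp [map]
  rfl

lemma map_add_hom {G H : BisetCat R D} (f g : G ⟶ H) (a : A.Ev G) :
    A.map (f + g) a = A.map f a + A.map g a := by
  simp [map, Functor.map_add]
  rfl

lemma map_zero_hom {G H : BisetCat R D} (a : A.Ev G) : A.map (0 : G ⟶ H) a = 0 := by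
  simp [map]
  rfl

lemma map_smul_hom {G H : BisetCat R D} (r : R) (f : G ⟶ H) (a : A.Ev G) :
    A.map (r • f) a = r • A.map f a := by
  simp [map, Functor.map_smul]
  rfl

lemma map_pull_mul {K G : BisetCat R D} (φ : K →* G) (a b : A.Ev G) :
    A.map (BisetCat.pull φ) (a * b) = A.map (BisetCat.pull φ) a * A.map (BisetCat.pull φ) b :=
  A.pull_mul φ a b

lemma map_pull_one {K G : BisetCat R D} (φ : K →* G) : A.map (BisetCat.pull φ) 1 = 1 :=
  A.pull_one φ

lemma map_push_mul {K G : BisetCat R D} (φ : K →* G) (a : A.Ev K) (b : A.Ev G) :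
    A.map (BisetCat.push φ) a * b =
      A.map (BisetCat.push φ) (a * A.map (BisetCat.pull φ) b) :=
  A.push_mul φ a b

lemma mul_map_push {K G : BisetCat R D} (φ : K →* G) (a : A.Ev K) (b : A.Ev G) :
    b * A.map (BisetCat.push φ) a =
      A.map (BisetCat.push φ) (A.map (BisetCat.pull φ) b * a) :=
  A.mul_push φ a b

lemma mul_map_defFst {G H : BisetCat R D} (b : A.Ev G) (a : A.Ev (G.prod H)) :
    b * A.map (G.defFst H) a = A.map (G.defFst H) (A.map (G.infFst H) b * a) :=
  A.mul_push (K := G.prod H) _ a b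

variable {A}

namespace Ideal

/-- The product `a * b` is the pullback of `a × b` along the diagonal, so each evaluation of an
ideal is an ideal of the algebra. -/
lemma mul_mem_left (I : A.Ideal) {G : BisetCat R D} (a : A.Ev G) {b : A.Ev G} (hb : b ∈ I.ev G) :
    a * b ∈ I.ev G := by
  have h := I.map_mem (BisetCat.pull G.diag) (I.cross_mem_left a hb)
  rwa [cross, map_pull_mul, ← map_comp, ← map_comp, BisetCat.infFst_comp_pull_diag,
    BisetCat.infSnd_comp_pull_diag, map_id, map_id] at h

lemma mul_mem_right (I : A.Ideal) {G : BisetCat R D} {a : A.Ev G} (b : A.Ev G)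
    (ha : a ∈ I.ev G) : a * b ∈ I.ev G := by
  have h := I.map_mem (BisetCat.pull G.diag) (I.cross_mem_right b ha)
  rwa [cross, map_pull_mul, ← map_comp, ← map_comp, BisetCat.infFst_comp_pull_diag,
    BisetCat.infSnd_comp_pull_diag, map_id, map_id] at h

lemma mem_gen_self {G : BisetCat R D} (x : A.Ev G) : x ∈ (gen x).ev G := by
  simp only [gen, Submodule.mem_iInf]
  exact fun I => I.2

lemma gen_le_iff {G : BisetCat R D} {x : A.Ev G} {I : A.Ideal} : gen x ≤ I ↔ x ∈ I.ev G :=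
  ⟨fun h => h G (mem_gen_self x), fun h _ _ ha => (Submodule.mem_iInf _).1 ha ⟨I, h⟩⟩

variable (A) in
/-- The submodules of the `A(H)` which are ideals, and are stable under `pull` and `push`, form an
ideal of `A`. -/
def ofPullPush (ev : ∀ G : BisetCat R D, Submodule R (A.Ev G))
    (pull_mem : ∀ {K G : BisetCat R D} (φ : K →* G) {a}, a ∈ ev G →
      A.map (BisetCat.pull φ) a ∈ ev K)
    (push_mem : ∀ {K G : BisetCat R D} (φ : K →* G) {a}, a ∈ ev K →
      A.map (BisetCat.push φ) a ∈ ev G)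
    (mul_mem_left : ∀ {G : BisetCat R D} (a : A.Ev G) {b}, b ∈ ev G → a * b ∈ ev G)
    (mul_mem_right : ∀ {G : BisetCat R D} {a} (b : A.Ev G), a ∈ ev G → a * b ∈ ev G) :
    A.Ideal where
  ev := ev
  map_mem f a ha := by
    refine BisetCat.hom_induction (R := R) (D := D)
      (P := fun {G _} f => ∀ a ∈ ev G, A.map f a ∈ ev _)
      (fun φ a ha => pull_mem φ ha) (fun φ a ha => push_mem φ ha) (fun f g hf hg a ha => ?_)
      (fun a _ => ?_) (fun f g hf hg a ha => ?_) (fun r f hf a ha => ?_) f a ha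
    · rw [map_comp]
      exact hg _ (hf a ha)
    · rw [map_zero_hom]
      exact zero_mem _
    · rw [map_add_hom]
      exact add_mem (hf a ha) (hg a ha)
    · rw [map_smul_hom]
      exact Submodule.smul_mem _ r (hf a ha)
  cross_mem_left a _ hb := mul_mem_left _ (pull_mem _ hb)
  cross_mem_right b ha := mul_mem_right _ (pull_mem _ ha)

end Ideal

end

/-! ### Principal ideals -/

section Commutative

variable {R : Type w} [CommRing R] {D : GroupClass.{u}} {A : GreenBisetFunctor.{u, w, v} R D}

variable (A) in
/-- The map `A(H × K) → A(H)`, `x ↦ Def (x ⬝ Inf e)`. -/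
def act {K : BisetCat R D} (e : A.Ev K) (H : BisetCat R D) : A.Ev (H.prod K) →ₗ[R] A.Ev H :=
  (A.map (H.defFst K)).comp (LinearMap.mulRight R (A.map (H.infSnd K) e))

lemma act_apply {K : BisetCat R D} (e : A.Ev K) (H : BisetCat R D) (x : A.Ev (H.prod K)) :
    A.act e H x = A.map (H.defFst K) (x * A.map (H.infSnd K) e) := rfl

/-- When all the `A(G)` are commutative, the ideal generated by `e ∈ A(K)` consists of the elements
`Def (x ⬝ Inf e)`, for `x ∈ A(H × K)`. -/
theorem gen_ev_eq_range (hcomm : ∀ (G : BisetCat R D) (a b : A.Ev G), a * b = b * a)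
    {K : BisetCat R D} (e : A.Ev K) (H : BisetCat R D) :
    (Ideal.gen e).ev H = LinearMap.range (A.act e H) := by
  apply le_antisymm
  · have hmul {G : BisetCat R D} (a : A.Ev G) {b} (hb : b ∈ LinearMap.range (A.act e G)) :
        a * b ∈ LinearMap.range (A.act e G) := by
      obtain ⟨x, rfl⟩ := hb
      -- Frobenius: `a * Def (x * Inf e) = Def (Inf a * x * Inf e)`.
      refine ⟨A.map (G.infFst K) a * x, ?_⟩
      rw [act_apply, act_apply, mul_map_defFst, _root_.mul_assoc]
    refine Ideal.gen_le_iff (I := Ideal.ofPullPush A (fun H => LinearMap.range (A.act e H))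
      ?_ ?_ (fun a _ hb => hmul a hb) (fun {G a} b ha => hcomm G a b ▸ hmul b ha)).2 ?_ H
    · rintro L H φ _ ⟨x, rfl⟩
      refine ⟨A.map (BisetCat.pull (BisetCat.prodMapId φ K)) x, ?_⟩
      rw [act_apply, act_apply, ← map_comp, BisetCat.defFst_comp_pull, map_comp, map_pull_mul,
        ← map_comp A (H.infSnd K), BisetCat.infSnd_comp_pull]
    · rintro L H φ _ ⟨x, rfl⟩
      refine ⟨A.map (BisetCat.push (BisetCat.prodMapId φ K)) x, ?_⟩
      rw [act_apply, act_apply, ← map_comp, BisetCat.defFst_comp_push, map_comp, map_push_mul,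
        ← map_comp A (H.infSnd K), BisetCat.infSnd_comp_pull]
    -- To reach `e` itself, take `x` to be the pushforward of `1` along the diagonal `Δ`. By
    -- Frobenius `x * Inf e` is `Δ_*(Δ^* Inf e) = Δ_* e`, and `Def` undoes `Δ_*`.
    · refine ⟨A.map (BisetCat.push K.diag) 1, ?_⟩
      rw [act_apply, map_push_mul, _root_.one_mul, ← map_comp A (K.infSnd K),
        BisetCat.infSnd_comp_pull_diag, ← map_comp, BisetCat.push_diag_comp_defFst, map_id, map_id]
  · rintro _ ⟨x, rfl⟩
    exact Ideal.map_mem _ _ (Ideal.mul_mem_left _ _ (Ideal.map_mem _ _ (Ideal.mem_gen_self e)))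

end Commutative

end GreenBisetFunctor

/-! ### Left fixed points, which detect the orbits with surjective left leg -/

namespace FinBiset

/-- A point `u` of a biset such that the left translates of `u` are right translates of `u`. -/
def IsLeftFixed {H G : Type u} [Group H] [Group G] (U : FinBiset H G) (u : U) : Prop :=
  ∀ h : H, ∃ g : G, h • u = MulOpposite.op g • u

lemma Iso.isLeftFixed {H G : Type u} [Group H] [Group G] {U V : FinBiset H G} (e : Iso U V)
    {v : V} (hv : V.IsLeftFixed v) : ∃ u, U.IsLeftFixed u := by
  obtain ⟨u, rfl⟩ := e.toEquiv.surjective v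
  refine ⟨u, fun h => ?_⟩
  obtain ⟨g, hg⟩ := hv h
  exact ⟨g, e.toEquiv.injective (((e.map_left h u).trans hg).trans (e.map_right _ u).symm)⟩

/-- In `H ×_L G` the left coordinate `x` is determined only up to the image of `α`. If each left
translate is also a right translate, every element of `H` must therefore come from `L`. -/
lemma surjective_of_isLeftFixed {L H G : Type u} [Group L] [Group H] [Group G] [Finite H]
    [Finite G] {α : L →* H} {β : L →* G} {u : ((push α).tensor (pull β)).carrier}
    (hu : ((push α).tensor (pull β)).IsLeftFixed u) : Function.Surjective α := by
  obtain ⟨(x : H), (y : G)⟩ := u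
  intro h
  -- Conjugated so that the translate of the coordinate `x` is `x * h`.
  obtain ⟨g, hg⟩ := hu (x * h * x⁻¹)
  obtain ⟨l, h1, -⟩ := Quotient.exact hg
  refine ⟨l, ?_⟩
  replace h1 : x * h * x⁻¹ * x = x * α l := h1
  simpa using h1.symm

end FinBiset

/-! ### Primitive idempotents of commutative split semisimple algebras -/

section SplitSemisimple

variable {𝕂 S : Type*} [Field 𝕂] [Ring S] [Algebra 𝕂 S]

/-- A commutative split semisimple algebra is a product of copies of the base field. -/
lemma IsSplitSemisimple.exists_algEquiv (h : IsSplitSemisimple 𝕂 S)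
    (hcomm : ∀ a b : S, a * b = b * a) : ∃ k : ℕ, Nonempty (S ≃ₐ[𝕂] (Fin k → 𝕂)) := by
  classical
  obtain ⟨k, n, hn, ⟨φ⟩⟩ := h
  refine ⟨k, ⟨φ.trans (AlgEquiv.piCongrRight fun i => ?_)⟩⟩
  -- For `a ≠ b` the matrix units at `(a, b)` and `(b, a)` do not commute, so all blocks have size
  -- one.
  have hsub : Subsingleton (Fin (n i)) := ⟨fun a b => by
    by_contra hab
    have h := hcomm (φ.symm (Pi.single i (Matrix.single a b 1)))
      (φ.symm (Pi.single i (Matrix.single b a 1)))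
    rw [← map_mul, ← map_mul, φ.symm.injective.eq_iff, ← Pi.single_mul, ← Pi.single_mul,
      (Pi.single_injective i).eq_iff, Matrix.single_mul_single_same,
      Matrix.single_mul_single_same] at h
    have := congrFun (congrFun h a) a
    simp [Ne.symm hab] at this⟩
  have hne : Nonempty (Fin (n i)) := ⟨⟨0, Nat.pos_of_ne_zero (hn i)⟩⟩
  refine (AlgEquiv.ofBijective (Algebra.ofId 𝕂 (Matrix (Fin (n i)) (Fin (n i)) 𝕂))
    ⟨RingHom.injective _, fun M => ⟨M hne.some hne.some, ?_⟩⟩).symm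
  ext a b
  rw [Subsingleton.elim a hne.some, Subsingleton.elim b hne.some]
  simp [Algebra.ofId_apply, Matrix.algebraMap_matrix_apply]

/-- In a commutative split semisimple algebra, a primitive idempotent spans an ideal. -/
lemma IsPrimitiveIdempotent.exists_mul_eq_smul {e : S} (he : IsPrimitiveIdempotent e)
    (h : IsSplitSemisimple 𝕂 S) (hcomm : ∀ a b : S, a * b = b * a) (a : S) :
    ∃ c : 𝕂, e * a = c • e := by
  classical
  obtain ⟨k, ⟨φ⟩⟩ := h.exists_algEquiv hcomm
  have hne : φ e ≠ 0 := fun h0 => he.ne_zero (by simpa using h0)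
  obtain ⟨i, hi⟩ := Function.ne_iff.1 hne
  have hidem (j : Fin k) : φ e j * φ e j = φ e j := by
    rw [← Pi.mul_apply, ← map_mul, he.idem.eq]
  have hi1 : φ e i = 1 := by
    simpa using mul_left_cancel₀ hi ((hidem i).trans (mul_one _).symm)
  let s : Fin k → 𝕂 := Pi.single i 1
  have hs : s * s = s := by
    rw [← Pi.single_mul, mul_one]
  have hsmul (f : Fin k → 𝕂) : s * f = f i • s := by
    ext j
    rcases eq_or_ne j i with rfl | hj
    · simp [s]
    · simp [s, hj]
  have hse : s * φ e = s := by
    rw [hsmul, hi1, one_smul]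
  have hes : φ e * s = s := by rw [mul_comm, hse]
  -- With `s` the coordinate idempotent at a point of the support of `e`, the splitting `e = s + (e
  -- - s)` is orthogonal, so primitivity forces `e = s`.
  have hzero : e - φ.symm s = 0 := by
    refine (he.eq_zero_or (φ.symm s) (e - φ.symm s) ?_ ?_ ?_ ?_ (by simp)).resolve_left ?_
    · exact (map_mul φ.symm s s).symm.trans (congrArg _ hs)
    · apply φ.injective
      have he2 : φ e * φ e = φ e := by rw [← map_mul, he.idem.eq]
      simp [mul_sub, sub_mul, hs, hse, hes, he2]
    · apply φ.injective
      simp [mul_sub, hs, hse]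
    · apply φ.injective
      simp [sub_mul, hs, hes]
    · intro h0
      have : s i = 0 := by
        rw [(map_eq_zero_iff φ.symm φ.symm.injective).1 h0]
        rfl
      simp [s] at this
  refine ⟨φ a i, ?_⟩
  have hes' : φ e = s := by
    rw [sub_eq_zero.1 hzero, AlgEquiv.apply_symm_apply]
  apply φ.injective
  rw [map_mul, map_smul, hes', hsmul]

/-- In a commutative split semisimple algebra, every `a` is a linear combination of the primitive
idempotents `e` such that `e * a ≠ 0`. -/
lemma IsSplitSemisimple.mem_span (h : IsSplitSemisimple 𝕂 S)
    (hcomm : ∀ a b : S, a * b = b * a) (a : S) :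
    a ∈ Submodule.span 𝕂 {e : S | IsPrimitiveIdempotent e ∧ e * a ≠ 0} := by
  classical
  obtain ⟨k, ⟨φ⟩⟩ := h.exists_algEquiv hcomm
  have ha : a = ∑ i, φ a i • φ.symm (Pi.single i 1) := by
    apply φ.injective
    ext j
    simp [Finset.sum_apply, Pi.single_apply]
  rw [ha]
  refine Submodule.sum_mem _ fun i _ => ?_
  by_cases hi : φ a i = 0
  · simp [hi]
  refine Submodule.smul_mem _ _ (Submodule.subset_span ⟨⟨?_, ?_, ?_⟩, ?_⟩)
  · apply φ.injective
    rw [map_mul, AlgEquiv.apply_symm_apply, ← Pi.single_mul, mul_one]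
  · rw [Ne, map_eq_zero_iff φ.symm φ.symm.injective, Pi.single_eq_zero_iff]
    exact one_ne_zero
  · intro f g hf hg hfg _ hsum
    have hs : Pi.single i 1 = φ f + φ g := by rw [← map_add, ← hsum, AlgEquiv.apply_symm_apply]
    have hmul (j : Fin k) : φ f j * φ g j = 0 := by
      rw [← Pi.mul_apply, ← map_mul, hfg, map_zero, Pi.zero_apply]
    have hidem {x : S} (hx : IsIdempotentElem x) (j : Fin k) : φ x j * φ x j = φ x j := by
      rw [← Pi.mul_apply, ← map_mul, hx.eq]
    have hoff (j : Fin k) (hj : j ≠ i) : φ f j = 0 ∧ φ g j = 0 := by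
      have hj0 : φ f j + φ g j = 0 := by
        rw [← Pi.add_apply, ← hs, Pi.single_eq_of_ne hj]
      have h1 : φ f j = 0 := by
        -- Multiplying `f_j + g_j = 0` by `f_j` leaves `f_j = 0`, as `f_j` is idempotent and `f_j
        -- g_j = 0`.
        have := congrArg (φ f j * ·) hj0
        simpa [mul_add, hmul j, hidem hf j] using this
      exact ⟨h1, by simpa [h1] using hj0⟩
    rcases mul_eq_zero.1 (hmul i) with h0 | h0
    · left
      apply φ.injective
      ext j
      rcases eq_or_ne j i with rfl | hj
      · simpa using h0
      · simpa using (hoff j hj).1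
    · right
      apply φ.injective
      ext j
      rcases eq_or_ne j i with rfl | hj
      · simpa using h0
      · simpa using (hoff j hj).2
  · rw [← ha]
    intro h0
    have := congrFun (congrArg φ h0) i
    simp [hi] at this

lemma IsSplitSemisimple.exists_mul_ne_zero (h : IsSplitSemisimple 𝕂 S)
    (hcomm : ∀ a b : S, a * b = b * a) {a : S} (ha : a ≠ 0) :
    ∃ e : S, IsPrimitiveIdempotent e ∧ e * a ≠ 0 := by
  by_contra! hne
  have hmem := h.mem_span hcomm a
  rw [show {e : S | IsPrimitiveIdempotent e ∧ e * a ≠ 0} = ∅ from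
    Set.eq_empty_of_forall_notMem fun e he => he.2 (hne e he.1), Submodule.span_empty] at hmem
  exact ha ((Submodule.mem_bot 𝕂).1 hmem)

end SplitSemisimple

namespace GreenBisetFunctor

/-! ### Images of the unity under bisets -/

section Linear

variable {R : Type w} [CommRing R] {D : GroupClass.{u}} {A : GreenBisetFunctor.{u, w, v} R D}
  {V : Type*} [AddCommGroup V] [Module R V]

-- The unity upstairs is the pullback of the unity downstairs, and `push φ` after `pull φ` is the
-- identity for surjective `φ`.
variable (A) in
lemma map_push_one_of_surjective {K G : BisetCat R D} {φ : K →* G}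
    (hφ : Function.Surjective φ) : A.map (BisetCat.push φ) 1 = 1 := by
  rw [← map_pull_one A φ, ← map_comp, BisetCat.pull_comp_push_of_surjective hφ, map_id]

/-- If a linear map `ψ` on `A(L)` kills the elements induced from the unity of proper subgroups,
its value at the image of the unity under a biset `U` is a multiple of `ψ 1`, which is
not zero if `U` has a suitable fixed point. -/
lemma exists_nsmul_of_map_push_eq_zero {L G : BisetCat R D} (ψ : A.Ev L →ₗ[R] V)
    (hψ : ∀ (M : BisetCat R D) (j : M →* L), Nat.card M < Nat.card L →
      ψ (A.map (BisetCat.push j) 1) = 0) (U : FinBiset L G) :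
    ∃ n : ℕ, ψ (A.map (BisetCat.ofBiset U) 1) = n • ψ 1 ∧
      ((∃ u, U.IsLeftFixed u) → n ≠ 0) := by
  refine BisetCat.biset_induction (P := fun U => ∃ n : ℕ,
    ψ (A.map (BisetCat.ofBiset U : G ⟶ L) 1) = n • ψ 1 ∧
      ((∃ u, U.IsLeftFixed u) → n ≠ 0)) ?_ ?_ ?_ ?_ U
  · rintro U V h ⟨n, hn, hfix⟩
    refine ⟨n, by rw [← BisetCat.ofBiset_eq h, hn], fun ⟨v, hv⟩ => hfix ?_⟩
    obtain ⟨e⟩ := h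
    exact e.isLeftFixed hv
  · refine ⟨0, ?_, fun ⟨u, _⟩ => PEmpty.elim u⟩
    rw [BisetCat.ofBiset_empty, map_zero_hom, map_zero, zero_smul]
  · rintro U V ⟨m, hm, hfix⟩ ⟨n, hn, hfix'⟩
    refine ⟨m + n, ?_, ?_⟩
    · rw [BisetCat.ofBiset_sum, map_add_hom, map_add, hm, hn, add_smul]
    · rintro ⟨u | u, hu⟩
      · have := hfix ⟨u, fun h => (hu h).imp fun g hg => Sum.inl_injective hg⟩
        omega
      · have := hfix' ⟨u, fun h => (hu h).imp fun g hg => Sum.inr_injective hg⟩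
        omega
  · intro M α β
    have hmap : A.map (BisetCat.ofBiset ((FinBiset.push α).tensor (FinBiset.pull β)) : G ⟶ L) 1 =
        A.map (BisetCat.push α) 1 := by
      rw [← BisetCat.ofBiset_comp (H := M), map_comp]
      exact congrArg _ (map_pull_one A β)
    rw [hmap]
    by_cases hα : Function.Surjective α
    -- An orbit `H ×_L G` with surjective left leg contributes `ψ 1` once. Any other orbit factors
    -- through the proper subgroup `α.range`, where `ψ` vanishes by `hψ`.
    · exact ⟨1, by rw [map_push_one_of_surjective A hα, one_smul], fun _ => one_ne_zero⟩
    · refine ⟨0, ?_, fun ⟨u, hu⟩ => (hα (FinBiset.surjective_of_isLeftFixed hu)).elim⟩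
      let ρ : M →* L.sub α.range := α.rangeRestrict
      let σ : L.sub α.range →* L := α.range.subtype
      have hρ : Function.Surjective ρ := α.rangeRestrict_surjective
      have hcomp : (BisetCat.push α : M ⟶ L) = BisetCat.push ρ ≫ BisetCat.push σ :=
        (BisetCat.push_comp_push ρ σ).symm
      rw [hcomp, map_comp, map_push_one_of_surjective A hρ, zero_smul]
      refine hψ (L.sub α.range) σ (lt_of_le_of_ne (Subgroup.card_le_card_group _) fun h => hα ?_)
      exact MonoidHom.range_eq_top.1 (Subgroup.eq_top_of_card_eq _ h)

/-- A homomorphism `i : M → L` such that `ψ (push i 1) ≠ 0`, and with `M` of minimal order. -/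
lemma exists_minimal_push (L : BisetCat R D) (ψ : A.Ev L →ₗ[R] V) (hψ : ψ 1 ≠ 0) :
    ∃ (M : BisetCat R D) (i : M →* L), ψ (A.map (BisetCat.push i) 1) ≠ 0 ∧
      ∀ (N : BisetCat R D) (j : N →* M), Nat.card N < Nat.card M →
        ψ (A.map (BisetCat.push i) (A.map (BisetCat.push j) 1)) = 0 := by
  induction hn : Nat.card L using Nat.strong_induction_on generalizing L with
  | _ n ih =>
  by_cases h : ∀ (N : BisetCat R D) (j : N →* L), Nat.card N < Nat.card L →
      ψ (A.map (BisetCat.push j) 1) = 0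
  · refine ⟨L, MonoidHom.id L, ?_, ?_⟩
    · rwa [BisetCat.push_id, map_id]
    · intro N j hj
      rw [BisetCat.push_id, map_id]
      exact h N j hj
  · push Not at h
    obtain ⟨N, j, hj, hne⟩ := h
    -- Minimality fails for `L`, so descend to the smaller group `N` with `ψ` composed with `push
    -- j`.
    obtain ⟨M, i, hi, hmin⟩ := ih _ (hn ▸ hj) N (ψ.comp (A.map (BisetCat.push j))) hne rfl
    refine ⟨M, j.comp i, ?_, fun N' j' hj' => ?_⟩
    · rw [← BisetCat.push_comp_push, map_comp]
      exact hi
    · rw [← BisetCat.push_comp_push, map_comp]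
      exact hmin N' j' hj'

end Linear

/-! ### Characteristic zero: `Res Ind 1` is not a zero divisor -/

section Field

variable {𝕂 : Type w} [Field 𝕂] {D : GroupClass.{u}} {A : GreenBisetFunctor.{u, w, v} 𝕂 D}

/-- In characteristic zero, `Res Ind 1` is not a divisor of zero. -/
lemma mul_pull_push_one_ne_zero [CharZero 𝕂] {K G : BisetCat 𝕂 D} (ι : K →* G) {f : A.Ev K}
    (hf : f ≠ 0) : f * A.map (BisetCat.pull ι) (A.map (BisetCat.push ι) 1) ≠ 0 := by
  intro h0
  -- Choose `L` so that `f * push i 1` survives while everything pushed into `L` from the unity of a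
  -- smaller group is killed. Applied to the unity, `U` then gives a multiple `n` of `f * push i 1`.
  obtain ⟨L, i, hne, hmin⟩ := exists_minimal_push K (LinearMap.mulLeft 𝕂 f) (by
    rwa [LinearMap.mulLeft_apply, _root_.mul_one])
  let U : FinBiset L K := (FinBiset.pull (ι.comp i)).tensor (FinBiset.push ι)
  obtain ⟨n, hn, hfix⟩ := exists_nsmul_of_map_push_eq_zero
    ((LinearMap.mulLeft 𝕂 f).comp (A.map (BisetCat.push i))) hmin U
  have hn0 : n ≠ 0 := by
    -- The point `[1, 1]` is fixed in the required sense: a left translation by `l` passes across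
    -- the tensor sign and becomes a right translation by `i l`. Hence `n > 0`.
    refine hfix ⟨Quotient.mk _ ((1 : G), (1 : G)), fun l =>
      ⟨i l, Quotient.sound ⟨ι (i l), ?_, ?_⟩⟩⟩
    · exact (_root_.mul_one (ι (i l))).trans (_root_.one_mul (ι (i l))).symm
    · exact (_root_.one_mul (ι (i l))).trans (_root_.mul_one (ι (i l))).symm
  have hU : (BisetCat.ofBiset U : K ⟶ L) =
      (BisetCat.push ι ≫ BisetCat.pull ι) ≫ BisetCat.pull i := by
    rw [Category.assoc, BisetCat.pull_comp_pull]
    exact (BisetCat.ofBiset_comp (H := G) _ _).symm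
  rw [hU, LinearMap.comp_apply, map_comp, map_comp, LinearMap.mulLeft_apply] at hn
  -- By Frobenius the same element contains the factor `f * Res Ind 1`, supposed to be zero. So `n •
  -- (f * push i 1) = 0` with `n ≠ 0` in `𝕂`.
  have hzero : f * A.map (BisetCat.push i) (A.map (BisetCat.pull i)
      (A.map (BisetCat.pull ι) (A.map (BisetCat.push ι) 1))) =
      f * A.map (BisetCat.pull ι) (A.map (BisetCat.push ι) 1) * A.map (BisetCat.push i) 1 := by
    rw [mul_map_push, mul_map_push, map_pull_mul, _root_.mul_one]
  rw [hzero, h0, zero_mul] at hn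
  have hn' : (n : 𝕂) • (f * A.map (BisetCat.push i) 1) = 0 := by
    rw [Nat.cast_smul_eq_nsmul]
    exact hn.symm
  exact hne ((smul_eq_zero.1 hn').resolve_left (Nat.cast_ne_zero.2 hn0))

/-! ### Ideals and primitive idempotents; descent to `ℳ` -/

variable (hcomm : ∀ (G : BisetCat 𝕂 D) (a b : A.Ev G), a * b = b * a)
    (hsplit : ∀ G : BisetCat 𝕂 D, IsSplitSemisimple 𝕂 (A.Ev G))

include hcomm hsplit

/-- `e * a` lies in the ideal and is a non-zero scalar multiple of `e`. -/
lemma Ideal.mem_of_mul_ne_zero (I : A.Ideal) {G : BisetCat 𝕂 D} {e a : A.Ev G} (he : e ∈ A.E G)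
    (ha : a ∈ I.ev G) (h : e * a ≠ 0) : e ∈ I.ev G := by
  obtain ⟨c, hc⟩ := IsPrimitiveIdempotent.exists_mul_eq_smul he (hsplit G) (hcomm G) a
  have hc0 : c ≠ 0 := by
    rintro rfl
    exact h (by rw [hc, zero_smul])
  have := (I.ev G).smul_mem c⁻¹ (I.mul_mem_left e ha)
  rwa [hc, inv_smul_smul₀ hc0] at this

/-- An ideal is spanned by the primitive idempotents which it contains. -/
lemma Ideal.le_of_forall_idempotent {I J : A.Ideal}
    (h : ∀ (G : BisetCat 𝕂 D), ∀ e ∈ A.E G, e ∈ I.ev G → e ∈ J.ev G) : I ≤ J := by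
  intro G a ha
  refine Submodule.span_le.2 ?_ ((hsplit G).mem_span (hcomm G) a)
  rintro e ⟨he, hea⟩
  exact h G e he (I.mem_of_mul_ne_zero hcomm hsplit he ha hea)

/-- A single `f` must satisfy both `f * Res e ≠ 0`, putting `f` in `gen e`, and `e * Ind f ≠ 0`,
putting `e` in `gen f`. If no `f` did, expanding `Res e` in primitive idempotents would give `e *
Ind (Res e) = 0`. But this element is `e * Ind 1`, and its restriction `Res e * Res Ind 1` is not
zero. -/
lemma exists_gen_eq_of_res_ne_zero [CharZero 𝕂] {G : BisetCat 𝕂 D} {e : A.Ev G} (he : e ∈ A.E G)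
    (K : Subgroup G) (h : A.map (G.res K) e ≠ 0) :
    ∃ f ∈ A.E (G.sub K), Ideal.gen f = Ideal.gen e := by
  let ι : G.sub K →* G := K.subtype
  change A.map (BisetCat.pull ι) e ≠ 0 at h
  have hne : e * A.map (BisetCat.push ι) 1 ≠ 0 := by
    intro h0
    refine mul_pull_push_one_ne_zero ι h ?_
    rw [← map_pull_mul, h0, map_zero]
  have hex : ∃ f ∈ A.E (G.sub K), f * A.map (BisetCat.pull ι) e ≠ 0 ∧
      e * A.map (BisetCat.push ι) f ≠ 0 := by
    by_contra! hall
    let F : A.Ev (G.sub K) →ₗ[𝕂] A.Ev G := (LinearMap.mulLeft 𝕂 e).comp (A.map (BisetCat.push ι))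
    have hmem : A.map (BisetCat.pull ι) e ∈ LinearMap.ker F := by
      refine Submodule.span_le.2 ?_ ((hsplit _).mem_span (hcomm _) (A.map (BisetCat.pull ι) e))
      rintro f ⟨hf, hfe⟩
      exact hall f hf hfe
    apply hne
    have h1 : e * A.map (BisetCat.push ι) (A.map (BisetCat.pull ι) e) = 0 := hmem
    -- Frobenius turns `Ind (Res e)` into `Ind 1 * e`; then `e * e = e`.
    rw [← _root_.one_mul (A.map (BisetCat.pull ι) e), ← map_push_mul, hcomm G _ e,
      ← _root_.mul_assoc, he.idem.eq] at h1
    exact h1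
  obtain ⟨f, hf, hfe, hef⟩ := hex
  refine ⟨f, hf, le_antisymm (Ideal.gen_le_iff.2 ?_) (Ideal.gen_le_iff.2 ?_)⟩
  · exact Ideal.mem_of_mul_ne_zero hcomm hsplit _ hf (Ideal.map_mem _ _ (Ideal.mem_gen_self e)) hfe
  · exact Ideal.mem_of_mul_ne_zero hcomm hsplit _ he (Ideal.map_mem _ _ (Ideal.mem_gen_self f)) hef

/-- Here `f * Def e = Def (Inf f * e)`, so `f * Def e ≠ 0` already implies `e * Inf f ≠ 0`, and the
two memberships come together in any characteristic. -/
lemma exists_gen_eq_of_defl_ne_zero {G : BisetCat 𝕂 D} {e : A.Ev G} (he : e ∈ A.E G)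
    (N : Subgroup G) [N.Normal] (h : A.map (G.defl N) e ≠ 0) :
    ∃ f ∈ A.E (G.quot N), Ideal.gen f = Ideal.gen e := by
  let π : G →* G.quot N := QuotientGroup.mk' N
  change A.map (BisetCat.push π) e ≠ 0 at h
  obtain ⟨f, hf, hfe⟩ := (hsplit (G.quot N)).exists_mul_ne_zero (hcomm _) h
  refine ⟨f, hf, le_antisymm (Ideal.gen_le_iff.2 ?_) (Ideal.gen_le_iff.2 ?_)⟩
  · exact Ideal.mem_of_mul_ne_zero hcomm hsplit _ hf (Ideal.map_mem _ _ (Ideal.mem_gen_self e)) hfe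
  · refine Ideal.mem_of_mul_ne_zero hcomm hsplit _ he
      (Ideal.map_mem _ (BisetCat.pull π) (Ideal.mem_gen_self f)) fun h0 => hfe ?_
    rw [mul_map_push, hcomm, h0, map_zero]

/-- The ideal generated by a primitive idempotent is generated by an element of `ℳ`. -/
theorem exists_mcPair_gen_eq [CharZero 𝕂] {G : BisetCat 𝕂 D} {e : A.Ev G} (he : e ∈ A.E G) :
    ∃ p : A.MCPair, Ideal.gen p.e = Ideal.gen e := by
  induction hn : Nat.card G using Nat.strong_induction_on generalizing G with
  | _ n ih =>
  -- If all proper restrictions and deflations of `e` vanish, `(G, e)` is itself in `ℳ`; otherwise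
  -- pass to a group of smaller order.
  by_cases hres : ∀ K : Subgroup G, K < ⊤ → A.map (G.res K) e = 0
  · by_cases hdef : ∀ (N : Subgroup G) [N.Normal], N ≠ ⊥ → A.map (G.defl N) e = 0
    · exact ⟨⟨G, ⟨e, ⟨he, hres⟩, he, hdef⟩, e, ⟨he, hres⟩, he, hdef⟩, rfl⟩
    · push Not at hdef
      obtain ⟨N, hN, hbot, hne⟩ := hdef
      obtain ⟨f, hf, hfe⟩ := exists_gen_eq_of_defl_ne_zero hcomm hsplit he N hne
      obtain ⟨p, hp⟩ := ih _ (by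
        rw [← hn]
        change Nat.card (G ⧸ N) < Nat.card G
        rw [Subgroup.card_eq_card_quotient_mul_card_subgroup N]
        exact lt_mul_of_one_lt_right Nat.card_pos (N.one_lt_card_iff_ne_bot.2 hbot)) hf rfl
      exact ⟨p, hp.trans hfe⟩
  · push Not at hres
    obtain ⟨K, hK, hne⟩ := hres
    obtain ⟨f, hf, hfe⟩ := exists_gen_eq_of_res_ne_zero hcomm hsplit he K hne
    obtain ⟨p, hp⟩ := ih _ (by
      rw [← hn]
      exact lt_of_le_of_ne (Subgroup.card_le_card_group _)
        fun h => hK.ne (Subgroup.eq_top_of_card_eq _ h)) hf rfl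
    exact ⟨p, hp.trans hfe⟩

/-- The elements `Def (x * Inf q.e)` make up `gen q.e` at the group of `p`, and `p.e` belongs to it
as soon as `p.e` times one of them is non-zero. By linearity it is enough to test primitive `x`. -/
lemma MCPair.dominates_iff (p q : A.MCPair) :
    p.Dominates q ↔ Ideal.gen p.e ≤ Ideal.gen q.e := by
  have hp : p.e ∈ A.E p.grp := p.e_mem.1.1
  rw [Ideal.gen_le_iff]
  constructor
  · rintro ⟨x, -, hx⟩
    refine Ideal.mem_of_mul_ne_zero hcomm hsplit _ hp ?_ hx
    exact Ideal.map_mem _ _ (Ideal.mul_mem_left _ _ (Ideal.map_mem _ _ (Ideal.mem_gen_self _)))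
  · intro h
    rw [gen_ev_eq_range hcomm] at h
    obtain ⟨y, hy⟩ := h
    by_contra hnot
    let F : A.Ev (p.grp.prod q.grp) →ₗ[𝕂] A.Ev p.grp :=
      (LinearMap.mulLeft 𝕂 p.e).comp (A.act q.e p.grp)
    have hmem : y ∈ LinearMap.ker F := by
      -- Were `F` zero on all primitive idempotents, it would vanish at `y`, whereas `F y = p.e *
      -- p.e = p.e`.
      refine Submodule.span_le.2 ?_ ((hsplit _).mem_span (hcomm _) y)
      rintro x ⟨hx, -⟩
      by_contra hne
      exact hnot ⟨x, hx, hne⟩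
    have h0 : p.e * A.act q.e p.grp y = 0 := hmem
    rw [hy, hp.idem.eq] at h0
    exact hp.ne_zero h0

/-- A primitive idempotent outside `I j` annihilates `I j`. Outside all of them it would annihilate
the sum, hence itself if it lay there. -/
lemma Ideal.mem_sum_iff {ι : Type*} (I : ι → A.Ideal) {G : BisetCat 𝕂 D} {e : A.Ev G}
    (he : e ∈ A.E G) : e ∈ (Ideal.sum I).ev G ↔ ∃ j, e ∈ (I j).ev G := by
  refine ⟨fun h => ?_, fun ⟨j, hj⟩ => Submodule.mem_iSup_of_mem j hj⟩
  by_contra! hall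
  have hle : (⨆ j, (I j).ev G) ≤ LinearMap.ker (LinearMap.mulLeft 𝕂 e) := by
    refine iSup_le fun j a ha => ?_
    by_contra hne
    exact hall j ((I j).mem_of_mul_ne_zero hcomm hsplit he ha hne)
  have h0 : e * e = 0 := hle h
  exact he.ne_zero (he.idem.eq.symm.trans h0)

end Field

end GreenBisetFunctor

end GreenBiset

/-! ### The isomorphism between ideals and closed subsets -/

theorem mainTheorem1 {𝕂 : Type w} [Field 𝕂] [CharZero 𝕂] (D : GroupClass.{u})
    (A : GreenBisetFunctor.{u, w, v} 𝕂 D)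
    (hfin : ∀ G : BisetCat 𝕂 D, Module.Finite 𝕂 (A.Ev G))
    (hcomm : ∀ (G : BisetCat 𝕂 D) (a b : A.Ev G), a * b = b * a)
    (hsplit : ∀ G : BisetCat 𝕂 D, IsSplitSemisimple 𝕂 (A.Ev G)) :
    ∃ _ : IsPreorder A.MCPair GreenBisetFunctor.MCPair.Dominates,
    ∃ Θ : A.Ideal ≃o {B : Set A.MCClass // IsUpperSet B},
      (∀ (I : A.Ideal) (p : A.MCPair), p.cls ∈ (Θ I : Set A.MCClass) ↔ p.e ∈ I.ev p.grp) ∧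
      ∀ (B : {B : Set A.MCClass // IsUpperSet B}) (r : A.MCClass → A.MCPair),
        (∀ c, (r c).cls = c) →
          Θ.symm B = GreenBisetFunctor.Ideal.sum
            (fun c : (B : Set A.MCClass) => GreenBisetFunctor.Ideal.gen (r c).e) := by
  have hdom := GreenBisetFunctor.MCPair.dominates_iff hcomm hsplit
  have hpre : IsPreorder A.MCPair GreenBisetFunctor.MCPair.Dominates :=
    { refl := fun p => (hdom p p).2 le_rfl
      trans := fun p q r h h' => (hdom p r).2 (((hdom p q).1 h).trans ((hdom q r).1 h')) }
  refine ⟨hpre, ?_⟩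
  -- The larger pair has the smaller ideal, so closed subsets are the upper sets.
  have hle (p q : A.MCPair) : q ≤ p ↔ GreenBisetFunctor.Ideal.gen p.e ≤ GreenBisetFunctor.Ideal.gen q.e := hdom p q
  have hmono (I : A.Ideal) {p q : A.MCPair} (hpq : q ≤ p) (hq : q.e ∈ I.ev q.grp) :
      p.e ∈ I.ev p.grp :=
    GreenBisetFunctor.Ideal.gen_le_iff.1 (((hle p q).1 hpq).trans (GreenBisetFunctor.Ideal.gen_le_iff.2 hq))
  -- Membership asks for one representative in `I`; by `hmono` all representatives then work, which
  -- is `hθ`.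
  let θ (I : A.Ideal) : {B : Set A.MCClass // IsUpperSet B} :=
    ⟨{c | ∃ p : A.MCPair, p.cls = c ∧ p.e ∈ I.ev p.grp}, by
      rintro _ d hcd ⟨p, rfl, hp⟩
      induction d using Quotient.inductionOn with
      | _ q => exact ⟨q, rfl, hmono I (toAntisymmetrization_le_toAntisymmetrization_iff.1 hcd) hp⟩⟩
  have hθ (I : A.Ideal) (p : A.MCPair) :
      p.cls ∈ (θ I : Set A.MCClass) ↔ p.e ∈ I.ev p.grp := by
    refine ⟨?_, fun h => ⟨p, rfl, h⟩⟩
    rintro ⟨q, hqp, hq⟩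
    exact hmono I (toAntisymmetrization_le_toAntisymmetrization_iff.1 hqp.le) hq
  have hθle {I J : A.Ideal} : θ I ≤ θ J ↔ I ≤ J := by
    constructor
    · intro h
      refine GreenBisetFunctor.Ideal.le_of_forall_idempotent hcomm hsplit fun G e he heI => ?_
      obtain ⟨p, hp⟩ := GreenBisetFunctor.exists_mcPair_gen_eq hcomm hsplit he
      rw [← GreenBisetFunctor.Ideal.gen_le_iff, ← hp, GreenBisetFunctor.Ideal.gen_le_iff] at heI ⊢
      exact (hθ J p).1 (h ((hθ I p).2 heI))
    · rintro h _ ⟨p, rfl, hp⟩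
      exact ⟨p, rfl, h _ hp⟩
  have hsum (B : {B : Set A.MCClass // IsUpperSet B}) (r : A.MCClass → A.MCPair)
      (hr : ∀ c, (r c).cls = c) :
      θ (GreenBisetFunctor.Ideal.sum fun c : (B : Set A.MCClass) => GreenBisetFunctor.Ideal.gen (r c).e) = B := by
    refine Subtype.ext (Set.ext fun c => ?_)
    rw [← hr c, hθ, GreenBisetFunctor.Ideal.mem_sum_iff hcomm hsplit _ (r c).e_mem.1.1]
    constructor
    · rintro ⟨d, hd⟩
      -- Primitivity puts `(r c).e` into a single summand `gen (r d).e`, so `c ≫ d ∈ B`, and `B` is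
      -- closed.
      have hdc : r d ≤ r c := (hle _ _).2 (GreenBisetFunctor.Ideal.gen_le_iff.2 hd)
      refine B.2 (toAntisymmetrization_le_toAntisymmetrization_iff.2 hdc) ?_
      change (r d).cls ∈ _
      rw [hr]
      exact d.2
    · intro hc
      rw [hr] at hc
      exact ⟨⟨c, hc⟩, GreenBisetFunctor.Ideal.mem_gen_self _⟩
  have hsurj : Function.Surjective θ := fun B =>
    ⟨_, hsum B (fun c => ofAntisymmetrization (· ≤ ·) c) (fun c =>
      toAntisymmetrization_ofAntisymmetrization _ c)⟩
  let Θ : A.Ideal ≃o {B : Set A.MCClass // IsUpperSet B} :=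
    RelIso.ofSurjective (OrderEmbedding.ofMapLEIff θ fun _ _ => hθle) hsurj
  refine ⟨Θ, hθ, fun B r hr => ?_⟩
  rw [OrderIso.symm_apply_eq]
  exact (hsum B r hr).symm
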